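/- Let $f:\mathbb{R}^n\to[0,\infty)$ be a surface tension, i.e. convex and positively $1$-homogeneous, whose Wulff shape $K=\bigcap_{|v|=1}\{x\in\mathbb{R}^n:\langle x,v\rangle<f(v)\}$ is nonempty (for instance, $f(v)>0$ for all $v\neq 0$), and let $g\ge 0$ be a potential with $g\in L^\infty_{loc}(\mathbb{R}^n)$. For a set of finite perimeter $E\subset\mathbb{R}^n$ with reduced boundary $\partial^*E$ and measure-theoretic outer unit normal $\nu_E$, put $$\mathcal F(E)=\int_{\partial^*E} f(\nu_E)\,d|D\mathbf 1_E|,\qquad \mathcal G(E)=\int_E g\,dx\in[0,\infty],\qquad \mathcal E(E)=\mathcal F(E)+\mathcal G(E),$$ where $|D\mathbf 1_E|$ is the perimeter measure of $E$ (which equals $\mathcal H^{n-1}$ restricted to $\partial^*E$). Let $m>0$, and let $E_m$ be a minimizer of $\mathcal E$ among all sets of finite perimeter of Lebesgue measure $m$. Suppose that $E_m$ is unique up to null sets: every other such minimizer differs from $E_m$ by a set of measure zero. Let $R>0$. Then for every $\epsilon>0$ there is $w_m(\epsilon)>0$ (depending on $n,f,g,m,R,\epsilon$) such that every set of finite perimeter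 $E\subset B_R$ (the ball of radius $R$ centred at the origin) with $|E|=m$ and $$\mathcal A(E,E_m):=\Big|\mathcal F(E)-\mathcal F(E_m)+\int_E g\,dx-\int_{E_m}g\,dx\Big|<w_m(\epsilon)$$ satisfies $$\frac{|E_m\,\Delta\,E|}{|E_m|}<\epsilon .$$ -/

import Mathlib

open MeasureTheory Filter Topology

noncomputable section

namespace Almgren

/-- The divergence of a vector field on `ℝⁿ`. -/
def divergence {n : ℕ} (φ : EuclideanSpace ℝ (Fin n) → EuclideanSpace ℝ (Fin n))
    (x : EuclideanSpace ℝ (Fin n)) : ℝ :=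
  ∑ i : Fin n, (fderiv ℝ φ x (EuclideanSpace.single i 1)) i

/-- The finite vector measure `σ μ` (with `|σ| = 1` `μ`-a.e., so that `μ` is its total variation)
is the Gauss-Green measure `-D 1_E` of `E`:
`∫_E div φ dx = ∫ ⟨φ, σ⟩ dμ` for all `φ ∈ C¹_c(ℝⁿ; ℝⁿ)`.
For given `E` the measure `μ` is unique, and `σ` is unique up to `μ`-null sets. -/
structure IsGaussGreen {n : ℕ} (E : Set (EuclideanSpace ℝ (Fin n)))
    (μ : Measure (EuclideanSpace ℝ (Fin n)))
    (σ : EuclideanSpace ℝ (Fin n) → EuclideanSpace ℝ (Fin n)) : Prop where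
  finite : IsFiniteMeasure μ
  measurable : Measurable σ
  norm_eq_one : ∀ᵐ x ∂μ, ‖σ x‖ = 1
  integral_div : ∀ φ : EuclideanSpace ℝ (Fin n) → EuclideanSpace ℝ (Fin n),
    ContDiff ℝ 1 φ → HasCompactSupport φ →
      ∫ x in E, divergence φ x = ∫ x, inner ℝ (φ x) (σ x) ∂μ

/-- `E` is a (Lebesgue measurable) set of finite perimeter: the distributional gradient of its
indicator function is a finite vector measure. -/
def HasFinitePerimeter {n : ℕ} (E : Set (EuclideanSpace ℝ (Fin n))) : Prop :=
  NullMeasurableSet E volume ∧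
    ∃ p : Measure (EuclideanSpace ℝ (Fin n)) ×
      (EuclideanSpace ℝ (Fin n) → EuclideanSpace ℝ (Fin n)), IsGaussGreen E p.1 p.2

open Classical in
/-- The perimeter measure `|D 1_E|` of a set of finite perimeter. -/
def perimeterMeasure {n : ℕ} (E : Set (EuclideanSpace ℝ (Fin n))) :
    Measure (EuclideanSpace ℝ (Fin n)) :=
  if h : HasFinitePerimeter E then h.2.choose.1 else 0

open Classical in
/-- A density of the Gauss-Green measure `-D 1_E` with respect to `|D 1_E|`. -/
def gaussGreenDensity {n : ℕ} (E : Set (EuclideanSpace ℝ (Fin n))) :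
    EuclideanSpace ℝ (Fin n) → EuclideanSpace ℝ (Fin n) :=
  if h : HasFinitePerimeter E then h.2.choose.2 else 0

/-- `-D 1_E (B_r(x)) / |D 1_E| (B_r(x))`. -/
def averagedNormal {n : ℕ} (E : Set (EuclideanSpace ℝ (Fin n)))
    (x : EuclideanSpace ℝ (Fin n)) (r : ℝ) : EuclideanSpace ℝ (Fin n) :=
  ⨍ y in Metric.closedBall x r, gaussGreenDensity E y ∂(perimeterMeasure E)

/-- De Giorgi's reduced boundary `∂* E`. -/
def reducedBoundary {n : ℕ} (E : Set (EuclideanSpace ℝ (Fin n))) :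
    Set (EuclideanSpace ℝ (Fin n)) :=
  {x | (∀ r > 0, 0 < perimeterMeasure E (Metric.closedBall x r)) ∧
    ∃ ν : EuclideanSpace ℝ (Fin n), ‖ν‖ = 1 ∧ Tendsto (averagedNormal E x) (𝓝[>] 0) (𝓝 ν)}

/-- The measure-theoretic outer unit normal `ν_E(x)`, for `x ∈ ∂* E`. -/
def outerNormal {n : ℕ} (E : Set (EuclideanSpace ℝ (Fin n)))
    (x : EuclideanSpace ℝ (Fin n)) : EuclideanSpace ℝ (Fin n) :=
  limUnder (𝓝[>] (0 : ℝ)) (averagedNormal E x)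

/-- A surface tension: a convex, positively `1`-homogeneous function `ℝⁿ → [0, ∞)`. -/
structure IsSurfaceTension {n : ℕ} (f : EuclideanSpace ℝ (Fin n) → ℝ) : Prop where
  nonneg : ∀ v, 0 ≤ f v
  convex : ConvexOn ℝ Set.univ f
  homogeneous : ∀ (t : ℝ) (v : EuclideanSpace ℝ (Fin n)), 0 < t → f (t • v) = t * f v

/-- The (open) Wulff shape `K` of `f`. -/
def wulffShape {n : ℕ} (f : EuclideanSpace ℝ (Fin n) → ℝ) : Set (EuclideanSpace ℝ (Fin n)) :=
  ⋂ v ∈ Metric.sphere (0 : EuclideanSpace ℝ (Fin n)) 1, {x | inner ℝ x v < f v}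

/-- A nonnegative potential in `L^∞_loc(ℝⁿ)`. -/
structure IsPotential {n : ℕ} (g : EuclideanSpace ℝ (Fin n) → ℝ) : Prop where
  nonneg : ∀ᵐ x, 0 ≤ g x
  locallyBounded : ∀ K : Set (EuclideanSpace ℝ (Fin n)), IsCompact K →
    MemLp g ⊤ (volume.restrict K)

/-- The surface energy `𝓕(E) = ∫_{∂* E} f(ν_E)` of a set of finite perimeter, the integral being
with respect to the perimeter measure `|D 1_E|`, that is, the surface measure on `∂* E`. -/
def surfaceEnergy {n : ℕ} (f : EuclideanSpace ℝ (Fin n) → ℝ)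
    (E : Set (EuclideanSpace ℝ (Fin n))) : ENNReal :=
  ∫⁻ x in reducedBoundary E, ENNReal.ofReal (f (outerNormal E x)) ∂(perimeterMeasure E)

/-- The potential energy `𝓖(E) = ∫_E g dx ∈ [0, ∞]`. -/
def potentialEnergy {n : ℕ} (g : EuclideanSpace ℝ (Fin n) → ℝ)
    (E : Set (EuclideanSpace ℝ (Fin n))) : ENNReal :=
  ∫⁻ x in E, ENNReal.ofReal (g x)

/-- The free energy `𝓔 = 𝓕 + 𝓖`. -/
def freeEnergy {n : ℕ} (f g : EuclideanSpace ℝ (Fin n) → ℝ)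
    (E : Set (EuclideanSpace ℝ (Fin n))) : ENNReal :=
  surfaceEnergy f E + potentialEnergy g E

/-- `E` minimizes the free energy among all sets of finite perimeter of mass `m`. -/
structure IsMinimizer {n : ℕ} (f g : EuclideanSpace ℝ (Fin n) → ℝ) (m : ℝ)
    (E : Set (EuclideanSpace ℝ (Fin n))) : Prop where
  finitePerimeter : HasFinitePerimeter E
  mass : volume E = ENNReal.ofReal m
  le : ∀ E' : Set (EuclideanSpace ℝ (Fin n)), HasFinitePerimeter E' →
    volume E' = ENNReal.ofReal m → freeEnergy f g E ≤ freeEnergy f g E'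

/-- The energy gap `𝓐(E, E') = |𝓕(E) - 𝓕(E') + ∫_E g - ∫_{E'} g|`, for sets of finite energy. -/
def energyGap {n : ℕ} (f g : EuclideanSpace ℝ (Fin n) → ℝ)
    (E E' : Set (EuclideanSpace ℝ (Fin n))) : ℝ :=
  |(surfaceEnergy f E).toReal - (surfaceEnergy f E').toReal
    + (potentialEnergy g E).toReal - (potentialEnergy g E').toReal|

end Almgren

end

/-! The argument is by compactness and contradiction. If no threshold works, there are sets `E k` of
mass `m` in the fixed ball whose energy gaps tend to zero while their relative distance to `Em`
stays at least `ε`. A limit of the `E k` in measure keeps the mass and has energy at most that of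
`Em`, so it is a minimizer; uniqueness identifies it with `Em`, a contradiction.

Bounded energy gives bounded perimeter (`IsGaussGreen.mul_perimeter_le`): although `f` may vanish in
some directions, a point of the Wulff shape makes it coercive after subtracting a linear function,
and linear functions integrate to zero against the Gauss-Green measure of a bounded set. Bounded
perimeter gives precompactness in measure (`exists_tendsto_volume_symmDiff`), since such sets are
uniformly approximated by finite unions of small cubes. The limit has finite perimeter by the Riesz
representation theorem and a polar decomposition (`exists_isGaussGreen_limit`). Its surface energy
does not exceed the limiting one (`IsSurfaceTension.lintegral_le_of_tendsto`), because `f` is a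
supremum of linear functions and the linear functionals of the Gauss-Green measure pass to the
limit. The potential energy is continuous inside the ball.

All limits are taken along one ultrafilter on `ℕ`, which replaces the extraction of subsequences. -/

namespace Almgren

/-! ### Test functions and comparison of measures. -/

/-- A smooth Urysohn function for a compact set inside an open set. -/
theorem exists_contDiff_bump {n : ℕ} {K U : Set (EuclideanSpace ℝ (Fin n))} (hK : IsCompact K)
    (hU : IsOpen U) (hKU : K ⊆ U) :
    ∃ η : EuclideanSpace ℝ (Fin n) → ℝ, ContDiff ℝ 1 η ∧ HasCompactSupport η ∧
      (∀ x ∈ K, η x = 1) ∧ (∀ x, x ∉ U → η x = 0) ∧ ∀ x, 0 ≤ η x ∧ η x ≤ 1 := by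
  obtain ⟨V, hVo, hKV, hVU, hVc⟩ := exists_open_between_and_isCompact_closure hK hU hKU
  obtain ⟨η, h0, h1, h01⟩ := exists_contMDiffMap_zero_one_of_isClosed
    (n := 1) (modelWithCornersSelf ℝ (EuclideanSpace ℝ (Fin n)))
    hVo.isClosed_compl hK.isClosed (Set.disjoint_compl_left_iff_subset.2 hKV)
  refine ⟨η, η.contMDiff.contDiff, ?_, fun x hx => by simpa using h1 hx,
    fun x hx => by simpa using h0 (fun hxV => hx (hVU (subset_closure hxV))),
    fun x => h01 x⟩
  refine HasCompactSupport.intro hVc fun x hx => ?_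
  simpa using h0 (fun hxV => hx (subset_closure hxV))

/-- Finite measures are ordered if they are ordered on nonnegative `C¹_c` functions. -/
theorem measure_le_of_forall_integral_le {n : ℕ} {κ ν : Measure (EuclideanSpace ℝ (Fin n))}
    [IsFiniteMeasure κ] [IsFiniteMeasure ν]
    (h : ∀ η : EuclideanSpace ℝ (Fin n) → ℝ, ContDiff ℝ 1 η → HasCompactSupport η →
      (∀ x, 0 ≤ η x) → ∫ x, η x ∂κ ≤ ∫ x, η x ∂ν) : κ ≤ ν := by
  have hc : ∀ K : Set (EuclideanSpace ℝ (Fin n)), IsCompact K → κ K ≤ ν K := by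
    intro K hK
    refine le_of_forall_gt fun c hc => ?_
    obtain ⟨U, hKU, hU, hUc⟩ := K.exists_isOpen_lt_of_lt c hc
    refine lt_of_le_of_lt ?_ hUc
    obtain ⟨η, hη, hηc, hη1, hη0, hη01⟩ := exists_contDiff_bump hK hU hKU
    have hi : ∀ ρ : Measure (EuclideanSpace ℝ (Fin n)), IsFiniteMeasure ρ → Integrable η ρ :=
      fun ρ _ => hη.continuous.integrable_of_hasCompactSupport hηc
    have h1 : κ.real K ≤ ∫ x, η x ∂κ := by
      rw [← integral_indicator_one hK.measurableSet]
      refine integral_mono ((integrable_const (1 : ℝ)).indicator hK.measurableSet)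
        (hi κ inferInstance) fun x => ?_
      by_cases hx : x ∈ K
      · simp [hx, hη1 x hx]
      · simp [hx, (hη01 x).1]
    have h2 : ∫ x, η x ∂ν ≤ ν.real U := by
      rw [← integral_indicator_one hU.measurableSet]
      refine integral_mono (hi ν inferInstance)
        ((integrable_const (1 : ℝ)).indicator hU.measurableSet) fun x => ?_
      by_cases hx : x ∈ U
      · simp [hx, (hη01 x).2]
      · simp [hx, hη0 x hx]
    have h3 := (h1.trans (h η hη hηc fun x => (hη01 x).1)).trans h2
    exact (ENNReal.toReal_le_toReal (measure_ne_top _ _) (measure_ne_top _ _)).1 h3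
  -- Outer regularity of `ν` gave the compact case; inner regularity of `κ` extends it to all
  -- measurable sets.
  refine Measure.le_iff.2 fun s hs => ?_
  refine le_of_forall_lt fun c hc' => ?_
  obtain ⟨K, hKs, hK, hcK⟩ := hs.exists_lt_isCompact hc'
  exact hcK.trans_le ((hc K hK).trans (measure_mono hKs))

/-! ### Gauss-Green measures and the reduced boundary. -/

theorem HasFinitePerimeter.isGaussGreen {n : ℕ} {E : Set (EuclideanSpace ℝ (Fin n))}
    (h : HasFinitePerimeter E) : IsGaussGreen E (perimeterMeasure E) (gaussGreenDensity E) := by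
  have := h.2.choose_spec
  simpa only [perimeterMeasure, gaussGreenDensity, dif_pos h] using this

theorem IsGaussGreen.integrable {n : ℕ} {E : Set (EuclideanSpace ℝ (Fin n))}
    {μ : Measure (EuclideanSpace ℝ (Fin n))} {σ : EuclideanSpace ℝ (Fin n) → EuclideanSpace ℝ (Fin n)}
    (h : IsGaussGreen E μ σ) : Integrable σ μ := by
  have := h.finite
  exact Integrable.of_bound h.measurable.aestronglyMeasurable 1
    (h.norm_eq_one.mono fun x hx => hx.le)

theorem IsGaussGreen.congr_ae {n : ℕ} {E E' : Set (EuclideanSpace ℝ (Fin n))}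
    {μ : Measure (EuclideanSpace ℝ (Fin n))} {σ : EuclideanSpace ℝ (Fin n) → EuclideanSpace ℝ (Fin n)}
    (h : IsGaussGreen E μ σ) (hE : E =ᵐ[volume] E') : IsGaussGreen E' μ σ :=
  ⟨h.finite, h.measurable, h.norm_eq_one, fun φ h1 h2 => by
    rw [← h.integral_div φ h1 h2, setIntegral_congr_set hE]⟩

/-- By Besicovitch differentiation, almost every point for the perimeter measure belongs to the
reduced boundary, and the outer normal is the density of the Gauss-Green measure. -/
theorem HasFinitePerimeter.ae_reducedBoundary {n : ℕ} {E : Set (EuclideanSpace ℝ (Fin n))}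
    (h : HasFinitePerimeter E) :
    ∀ᵐ x ∂(perimeterMeasure E), x ∈ reducedBoundary E ∧ outerNormal E x = gaussGreenDensity E x := by
  have hG := h.isGaussGreen
  have := hG.finite
  have hb := (Besicovitch.vitaliFamily (perimeterMeasure E)).ae_tendsto_average
    hG.integrable.locallyIntegrable
  filter_upwards [hb, hG.norm_eq_one, Measure.support_mem_ae (μ := perimeterMeasure E)]
    with x hx hx1 hxs
  have ht : Tendsto (averagedNormal E x) (𝓝[>] 0) (𝓝 (gaussGreenDensity E x)) :=
    hx.comp (Besicovitch.tendsto_filterAt (perimeterMeasure E) x)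
  refine ⟨⟨fun r hr => ?_, _, hx1, ht⟩, ht.limUnder_eq⟩
  exact (Measure.mem_support_iff_forall x).1 hxs _ (Metric.closedBall_mem_nhds x hr)

/-- The reduced boundary has full perimeter measure, so it can be dropped from the energy. The later
analysis then needs only a pair `μ`, `σ` and no fine properties of the boundary. -/
theorem HasFinitePerimeter.surfaceEnergy_eq {n : ℕ} {E : Set (EuclideanSpace ℝ (Fin n))}
    (h : HasFinitePerimeter E) (f : EuclideanSpace ℝ (Fin n) → ℝ) :
    surfaceEnergy f E = ∫⁻ x, ENNReal.ofReal (f (gaussGreenDensity E x)) ∂(perimeterMeasure E) := by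
  have hae := h.ae_reducedBoundary
  have hr : (perimeterMeasure E).restrict (reducedBoundary E) = perimeterMeasure E := by
    rw [Measure.restrict_congr_set (t := Set.univ), Measure.restrict_univ]
    exact eventuallyEq_univ.2 (hae.mono fun x hx => hx.1)
  rw [surfaceEnergy, hr]
  exact lintegral_congr_ae (hae.mono fun x hx => by simp only [hx.2])

/-! ### Convex analysis of surface tensions. -/

namespace IsSurfaceTension

variable {n : ℕ} {f : EuclideanSpace ℝ (Fin n) → ℝ}

theorem continuous (hf : IsSurfaceTension f) : Continuous f :=
  hf.convex.locallyLipschitz.continuous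

theorem map_add_le (hf : IsSurfaceTension f) (v w : EuclideanSpace ℝ (Fin n)) :
    f (v + w) ≤ f v + f w := by
  have h := hf.convex.2 (Set.mem_univ v) (Set.mem_univ w) (show (0 : ℝ) ≤ 1 / 2 by norm_num)
    (show (0 : ℝ) ≤ 1 / 2 by norm_num) (by norm_num)
  have h2 := hf.homogeneous 2 ((1 / 2 : ℝ) • v + (1 / 2 : ℝ) • w) (by norm_num)
  rw [show (2 : ℝ) • ((1 / 2 : ℝ) • v + (1 / 2 : ℝ) • w) = v + w by
    rw [smul_add, smul_smul, smul_smul]; norm_num] at h2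
  simp only [smul_eq_mul] at h
  linarith

theorem map_zero (hf : IsSurfaceTension f) : f 0 = 0 := by
  have := hf.homogeneous 2 0 (by norm_num)
  rw [smul_zero] at this
  linarith

theorem exists_le_mul_norm (hf : IsSurfaceTension f) :
    ∃ L : ℝ, 0 ≤ L ∧ ∀ v, f v ≤ L * ‖v‖ := by
  obtain ⟨L, hL⟩ := (isCompact_sphere (0 : EuclideanSpace ℝ (Fin n)) 1).bddAbove_image
    hf.continuous.continuousOn
  refine ⟨max L 0, le_max_right _ _, fun v => ?_⟩
  rcases eq_or_ne v 0 with rfl | hv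
  · simp [hf.map_zero]
  have hv' : 0 < ‖v‖ := norm_pos_iff.2 hv
  have h1 := hL ⟨‖v‖⁻¹ • v, by simp [norm_smul, hv'.ne'], rfl⟩
  have h2 := hf.homogeneous ‖v‖ (‖v‖⁻¹ • v) hv'
  rw [smul_smul, mul_inv_cancel₀ hv'.ne', one_smul] at h2
  rw [h2, mul_comm]
  gcongr
  exact h1.trans (le_max_left _ _)

/-- The surface tension is the support function of its closed Wulff shape. -/
theorem exists_inner_eq (hf : IsSurfaceTension f) (v : EuclideanSpace ℝ (Fin n)) :
    ∃ a : EuclideanSpace ℝ (Fin n), (∀ w, inner ℝ a w ≤ f w) ∧ inner ℝ a v = f v := by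
  have key : ∃ ℓ : EuclideanSpace ℝ (Fin n) →ₗ[ℝ] ℝ, (∀ w, ℓ w ≤ f w) ∧ ℓ v = f v := by
    rcases eq_or_ne v 0 with rfl | hv
    · exact ⟨0, fun w => hf.nonneg w, by simp [hf.map_zero]⟩
    obtain ⟨ℓ, h1, h2⟩ := exists_extension_of_le_sublinear
      (LinearPMap.mkSpanSingleton v (f v) hv) f (fun c hc x => hf.homogeneous c x hc)
      hf.map_add_le (by
        rintro ⟨x, hx⟩
        obtain ⟨t, rfl⟩ := Submodule.mem_span_singleton.1 hx
        rw [LinearPMap.mkSpanSingleton'_apply]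
        rcases lt_trichotomy t 0 with ht | rfl | ht
        -- On negative multiples of `v` the functional is nonpositive, so `0 ≤ f` is enough for
        -- domination before applying Hahn-Banach.
        · exact (mul_nonpos_of_nonpos_of_nonneg ht.le (hf.nonneg v)).trans (hf.nonneg _)
        · simp [hf.map_zero]
        · simp [hf.homogeneous t v ht])
    refine ⟨ℓ, h2, ?_⟩
    exact (h1 ⟨v, Submodule.mem_span_singleton_self v⟩).trans
      (LinearPMap.mkSpanSingleton_apply ℝ ℝ hv (f v))
  obtain ⟨ℓ, h1, h2⟩ := key
  have hℓ : ∀ w, inner ℝ ((InnerProductSpace.toDual ℝ _).symm (LinearMap.toContinuousLinearMap ℓ)) w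
      = ℓ w := fun w => by simp
  exact ⟨_, fun w => (hℓ w).le.trans (h1 w), (hℓ v).trans h2⟩

/-- If the Wulff shape is nonempty, then `f` is coercive up to a linear function. -/
theorem exists_coercive (hf : IsSurfaceTension f) (hK : (wulffShape f).Nonempty) :
    ∃ (a : EuclideanSpace ℝ (Fin n)) (c : ℝ), 0 < c ∧ ∀ v, ‖v‖ = 1 → c + inner ℝ a v ≤ f v := by
  obtain ⟨a, ha⟩ := hK
  have ha' : ∀ v, ‖v‖ = 1 → inner ℝ a v < f v := fun v hv => by
    simpa using Set.mem_iInter₂.1 ha v (by simpa using hv)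
  -- In dimension zero the sphere is empty and any `c` works; otherwise `c` is the positive minimum
  -- of `f - ⟨a, ·⟩` on the sphere.
  rcases (Metric.sphere (0 : EuclideanSpace ℝ (Fin n)) 1).eq_empty_or_nonempty with he | hne
  · refine ⟨a, 1, one_pos, fun v hv => ?_⟩
    have : v ∈ Metric.sphere (0 : EuclideanSpace ℝ (Fin n)) 1 := by simpa using hv
    simp [he] at this
  obtain ⟨v₀, hv₀, hmin⟩ := (isCompact_sphere (0 : EuclideanSpace ℝ (Fin n)) 1).exists_isMinOn hne
    (f := fun v => f v - inner ℝ a v)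
    (hf.continuous.sub (continuous_const.inner continuous_id)).continuousOn
  refine ⟨a, f v₀ - inner ℝ a v₀, sub_pos.2 (ha' v₀ (by simpa using hv₀)), fun v hv => ?_⟩
  have := hmin (show v ∈ Metric.sphere (0 : EuclideanSpace ℝ (Fin n)) 1 by simpa using hv)
  simp only [Set.mem_ofPred_eq] at this
  linarith

end IsSurfaceTension

/-! ### Directional derivatives and translations. -/

theorem divergence_smul_const {n : ℕ} {η : EuclideanSpace ℝ (Fin n) → ℝ} (hη : ContDiff ℝ 1 η)
    (a x : EuclideanSpace ℝ (Fin n)) :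
    divergence (fun y => η y • a) x = fderiv ℝ η x a := by
  have hd : DifferentiableAt ℝ η x := (hη.differentiable one_ne_zero) x
  have ha : a = ∑ i, a i • EuclideanSpace.single i (1 : ℝ) := by
    ext j
    simp [Finset.sum_apply, Pi.single_apply]
  conv_rhs => rw [ha, map_sum]
  refine Finset.sum_congr rfl fun i _ => ?_
  rw [fderiv_smul_const hd]
  simp [mul_comm]

theorem IsGaussGreen.integral_fderiv {n : ℕ} {E : Set (EuclideanSpace ℝ (Fin n))}
    {μ : Measure (EuclideanSpace ℝ (Fin n))} {σ : EuclideanSpace ℝ (Fin n) → EuclideanSpace ℝ (Fin n)}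
    (h : IsGaussGreen E μ σ) {η : EuclideanSpace ℝ (Fin n) → ℝ} (hη : ContDiff ℝ 1 η)
    (hc : HasCompactSupport η) (a : EuclideanSpace ℝ (Fin n)) :
    ∫ x in E, fderiv ℝ η x a = ∫ x, η x * inner ℝ a (σ x) ∂μ := by
  have := h.integral_div (fun y => η y • a) (hη.smul contDiff_const) hc.smul_right
  simpa only [divergence_smul_const hη, real_inner_smul_left] using this

theorem IsGaussGreen.abs_integral_mul_inner_le {n : ℕ} {E : Set (EuclideanSpace ℝ (Fin n))}
    {μ : Measure (EuclideanSpace ℝ (Fin n))} {σ : EuclideanSpace ℝ (Fin n) → EuclideanSpace ℝ (Fin n)}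
    (h : IsGaussGreen E μ σ) {η : EuclideanSpace ℝ (Fin n) → ℝ} (h1 : ∀ x, |η x| ≤ 1)
    (a : EuclideanSpace ℝ (Fin n)) :
    |∫ x, η x * inner ℝ a (σ x) ∂μ| ≤ ‖a‖ * μ.real Set.univ := by
  have := h.finite
  rw [← Real.norm_eq_abs]
  refine norm_integral_le_of_norm_le_const (μ := μ) ?_
  filter_upwards [h.norm_eq_one] with x hx
  rw [norm_mul]
  calc ‖η x‖ * ‖inner ℝ a (σ x)‖ ≤ 1 * (‖a‖ * ‖σ x‖) :=
        mul_le_mul (h1 x) (norm_inner_le_norm _ _) (norm_nonneg _) zero_le_one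
    _ = ‖a‖ := by rw [hx]; ring

/-- Differentiate `∫_E η (x - t v)` in `t`: by Gauss-Green the derivative is an integral of a
translate of `η` against `-⟨v, σ⟩ μ`, bounded by `‖v‖` times the perimeter. The mean value
inequality on `[0, 1]` concludes. -/
theorem IsGaussGreen.abs_integral_translate_sub_le {n : ℕ} {E : Set (EuclideanSpace ℝ (Fin n))}
    {μ : Measure (EuclideanSpace ℝ (Fin n))} {σ : EuclideanSpace ℝ (Fin n) → EuclideanSpace ℝ (Fin n)}
    (h : IsGaussGreen E μ σ) (hE : volume E ≠ ⊤) {η : EuclideanSpace ℝ (Fin n) → ℝ}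
    (hη : ContDiff ℝ 1 η) (hc : HasCompactSupport η) (h1 : ∀ x, |η x| ≤ 1)
    (v : EuclideanSpace ℝ (Fin n)) :
    |(∫ x in E, η (x - v)) - ∫ x in E, η x| ≤ ‖v‖ * μ.real Set.univ := by
  have : IsFiniteMeasure (volume.restrict E) := ⟨by simpa using hE.lt_top⟩
  have hdc : Continuous fun x => fderiv ℝ η x v :=
    (hη.continuous_fderiv one_ne_zero).clm_apply continuous_const
  obtain ⟨M, hM⟩ := (hη.continuous_fderiv one_ne_zero).bounded_above_of_compact_support
    (hc.fderiv (𝕜 := ℝ))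
  have hder : ∀ t : ℝ, HasDerivAt (fun t : ℝ => ∫ x in E, η (x - t • v))
      (∫ x in E, -(fderiv ℝ η (x - t • v) v)) t := by
    intro t
    refine (hasDerivAt_integral_of_dominated_loc_of_deriv_le (s := Set.univ)
      (bound := fun _ => M * ‖v‖) (F := fun t x => η (x - t • v))
      (F' := fun t x => -(fderiv ℝ η (x - t • v) v)) univ_mem ?_ ?_ ?_ ?_ ?_ ?_).2
    · exact .of_forall fun s =>
        (hη.continuous.comp (continuous_id.sub continuous_const)).aestronglyMeasurable
    · exact Integrable.of_bound
        (hη.continuous.comp (continuous_id.sub continuous_const)).aestronglyMeasurable 1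
        (.of_forall fun x => h1 _)
    · exact (hdc.comp (continuous_id.sub continuous_const)).neg.aestronglyMeasurable
    · refine .of_forall fun x s _ => ?_
      rw [norm_neg]
      exact (ContinuousLinearMap.le_opNorm _ _).trans (by gcongr; exact hM _)
    · exact integrable_const _
    · refine .of_forall fun x s _ => ?_
      have h2 : HasDerivAt (fun s : ℝ => x - s • v) (-v) s := by
        simpa using ((hasDerivAt_id s).smul_const v).const_sub x
      have h3 := ((hη.differentiable one_ne_zero) (x - s • v)).hasFDerivAt.comp_hasDerivAt s h2
      simpa [Function.comp_def] using h3
  have hbound : ∀ t : ℝ, ‖∫ x in E, -(fderiv ℝ η (x - t • v) v)‖ ≤ ‖v‖ * μ.real Set.univ := by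
    intro t
    have ht : ContDiff ℝ 1 fun x => η (x - t • v) := hη.comp (contDiff_id.sub contDiff_const)
    have htc : HasCompactSupport fun x => η (x - t • v) :=
      hc.comp_homeomorph (Homeomorph.subRight (t • v))
    have := h.integral_fderiv ht htc v
    simp only [fderiv_comp_sub] at this
    rw [integral_neg, norm_neg, this]
    exact h.abs_integral_mul_inner_le (fun x => h1 _) v
  have := norm_image_sub_le_of_norm_deriv_le_segment_01' (f := fun t : ℝ => ∫ x in E, η (x - t • v))
    (fun t _ => (hder t).hasDerivWithinAt) fun t _ => hbound t
  simpa using this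

/-- A set of finite perimeter differs from its translate by at most the perimeter times the length
of the translation. -/
theorem IsGaussGreen.volume_diff_translate_le {n : ℕ} {E : Set (EuclideanSpace ℝ (Fin n))}
    {μ : Measure (EuclideanSpace ℝ (Fin n))} {σ : EuclideanSpace ℝ (Fin n) → EuclideanSpace ℝ (Fin n)}
    (h : IsGaussGreen E μ σ) (hEm : MeasurableSet E) (hE : volume E ≠ ⊤)
    (v : EuclideanSpace ℝ (Fin n)) :
    volume {x | x ∈ E ∧ x + v ∉ E} ≤ ENNReal.ofReal (‖v‖ * μ.real Set.univ) := by
  have hA : MeasurableSet {x | x ∈ E ∧ x + v ∉ E} :=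
    hEm.inter ((measurable_add_const v) hEm.compl)
  refine le_of_forall_lt fun c hc => ?_
  obtain ⟨K, hKA, hK, hcK⟩ := hA.exists_lt_isCompact hc
  refine hcK.trans_le ?_
  have hKtop : volume K ≠ ⊤ := hK.measure_lt_top.ne
  rw [← ENNReal.ofReal_toReal hKtop]
  refine ENNReal.ofReal_le_ofReal (le_of_forall_pos_le_add fun ε hε => ?_)
  obtain ⟨U, hKU, hU, -, hUK⟩ := hK.measurableSet.exists_isOpen_sdiff_lt hKtop
    (ENNReal.ofReal_pos.2 hε).ne'
  -- The bump separates the two integrals: `∫_E η` is at least the volume of `K`, while `∫_E η (x -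
  -- v)` is small because `K + v` misses `E`, leaving only the thin layer `U \ K`.
  obtain ⟨η, hη, hηc, hη1, hη0, hη01⟩ := exists_contDiff_bump hK hU hKU
  have hint : Integrable η := hη.continuous.integrable_of_hasCompactSupport hηc
  have h1 : volume.real K ≤ ∫ x in E, η x := by
    rw [← integral_indicator_one hK.measurableSet, ← integral_indicator hEm]
    refine integral_mono ((integrable_indicator_iff hK.measurableSet).2
      (integrableOn_const hKtop)) (hint.indicator hEm) fun x => ?_
    by_cases hx : x ∈ K
    · simp [hx, hη1 x hx, (hKA hx).1]
    · simp only [hx, not_false_eq_true, Set.indicator_of_notMem]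
      exact Set.indicator_nonneg (fun y _ => (hη01 y).1) x
  have hUm : MeasurableSet (U \ K) := hU.measurableSet.diff hK.measurableSet
  have hUt : volume (U \ K) ≠ ⊤ := (hUK.trans ENNReal.ofReal_lt_top).ne
  have hUi : Integrable ((U \ K).indicator (1 : EuclideanSpace ℝ (Fin n) → ℝ)) :=
    (integrable_indicator_iff hUm).2 (integrableOn_const hUt)
  have h2 : ∫ x in E, η (x - v) ≤ ε := by
    calc ∫ x in E, η (x - v)
        ≤ ∫ x, (U \ K).indicator (1 : EuclideanSpace ℝ (Fin n) → ℝ) (x - v) := by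
          rw [← integral_indicator hEm]
          refine integral_mono ((hint.comp_sub_right v).indicator hEm)
            (hUi.comp_sub_right v) fun x => ?_
          by_cases hx : x ∈ E
          · have hxK : x - v ∉ K := fun hxK => (hKA hxK).2 (by simpa using hx)
            by_cases hxU : x - v ∈ U
            · simp [hx, hxK, hxU, (hη01 (x - v)).2]
            · simp [hx, hxU, hη0 _ hxU]
          · simp only [hx, not_false_eq_true, Set.indicator_of_notMem]
            exact Set.indicator_nonneg (fun y _ => zero_le_one) _
      _ = volume.real (U \ K) := by
          rw [integral_sub_right_eq_self (fun x => (U \ K).indicator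
            (1 : EuclideanSpace ℝ (Fin n) → ℝ) x) v, integral_indicator_one hUm]
      _ ≤ ε := ENNReal.toReal_le_of_le_ofReal hε.le hUK.le
  have h3 := h.abs_integral_translate_sub_le hE hη hηc
    (fun x => abs_le.2 ⟨by linarith [(hη01 x).1], (hη01 x).2⟩) v
  have h4 := (abs_le.1 h3).1
  change volume.real K ≤ _
  linarith

/-! ### Approximation by cubes and total boundedness. -/

theorem volume_cube {n : ℕ} (a : Fin n → ℝ) (d : ℝ) :
    volume {x : EuclideanSpace ℝ (Fin n) | ∀ i, x i ∈ Set.Ico (a i) (a i + d)}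
      = ENNReal.ofReal d ^ n := by
  have hs : {x : EuclideanSpace ℝ (Fin n) | ∀ i, x i ∈ Set.Ico (a i) (a i + d)} =
      (MeasurableEquiv.toLp 2 (Fin n → ℝ)).symm ⁻¹'
        (Set.univ.pi fun i => Set.Ico (a i) (a i + d)) := by
    ext x; simp
  rw [hs, (EuclideanSpace.volume_preserving_symm_measurableEquiv_toLp (Fin n)).measure_preimage
    (MeasurableSet.univ_pi fun i => measurableSet_Ico).nullMeasurableSet, Real.volume_pi_Ico]
  simp

theorem norm_le_of_forall_abs_le {n : ℕ} {x : EuclideanSpace ℝ (Fin n)} {δ : ℝ} (hδ : 0 ≤ δ)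
    (h : ∀ i, |x i| ≤ δ) : ‖x‖ ≤ n * δ := by
  rw [EuclideanSpace.norm_eq]
  refine Real.sqrt_le_iff.2 ⟨by positivity, ?_⟩
  calc ∑ i, ‖x i‖ ^ 2 ≤ ∑ _i : Fin n, δ ^ 2 := by
        gcongr with i
        exact h i
    _ = n * δ ^ 2 := by simp
    _ ≤ (n * δ) ^ 2 := by
        rw [mul_pow]
        gcongr
        exact_mod_cast Nat.le_self_pow two_ne_zero n

/-- The pairs of points at distance less than `δ` in every coordinate, the first one inside and the
second one outside a set of finite perimeter. -/
theorem IsGaussGreen.volume_pairs_le {n : ℕ} {E : Set (EuclideanSpace ℝ (Fin n))}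
    {μ : Measure (EuclideanSpace ℝ (Fin n))} {σ : EuclideanSpace ℝ (Fin n) → EuclideanSpace ℝ (Fin n)}
    (h : IsGaussGreen E μ σ) (hEm : MeasurableSet E) (hE : volume E ≠ ⊤) {δ : ℝ} (hδ : 0 < δ) :
    (volume.prod volume) {p : EuclideanSpace ℝ (Fin n) × EuclideanSpace ℝ (Fin n) |
        p.1 ∈ E ∧ p.2 ∉ E ∧ ∀ i, |p.2 i - p.1 i| < δ}
      ≤ ENNReal.ofReal (n * δ * μ.real Set.univ) * ENNReal.ofReal (2 * δ) ^ n := by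
  set T := {p : EuclideanSpace ℝ (Fin n) × EuclideanSpace ℝ (Fin n) |
        p.1 ∈ E ∧ p.2 ∉ E ∧ ∀ i, |p.2 i - p.1 i| < δ} with hT
  have hTm : MeasurableSet T := by
    refine (measurable_fst hEm).inter ((measurable_snd hEm.compl).inter ?_)
    change MeasurableSet {p : EuclideanSpace ℝ (Fin n) × EuclideanSpace ℝ (Fin n) |
      ∀ i, |p.2 i - p.1 i| < δ}
    rw [Set.ofPred_forall]
    refine MeasurableSet.iInter fun i => ?_
    exact (isOpen_lt (by fun_prop) continuous_const).measurableSet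
  set B := {x : EuclideanSpace ℝ (Fin n) | ∀ i, x i ∈ Set.Ico (-δ) (-δ + 2 * δ)} with hB
  have hBm : MeasurableSet B := by
    rw [hB, Set.ofPred_forall]
    refine MeasurableSet.iInter fun i => ?_
    exact (show Measurable fun x : EuclideanSpace ℝ (Fin n) => x i by fun_prop) measurableSet_Ico
  -- The shear `(x, v) ↦ (x, x + v)` preserves volume. Slicing at fixed `v` reduces to the
  -- translation estimate, and the relevant `v` lie in a cube of side `2 * δ`.
  have hmp := measurePreserving_prod_add (volume : Measure (EuclideanSpace ℝ (Fin n)))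
    (volume : Measure (EuclideanSpace ℝ (Fin n)))
  rw [← hmp.measure_preimage hTm.nullMeasurableSet, Measure.prod_apply_symm (hmp.measurable hTm),
    ← volume_cube (fun _ => -δ) (2 * δ), ← hB, ← lintegral_indicator_const hBm]
  refine lintegral_mono fun v => ?_
  by_cases hv : ∀ i, |v i| < δ
  · have hvB : v ∈ B := fun i => ⟨(abs_lt.1 (hv i)).1.le, by linarith [(abs_lt.1 (hv i)).2]⟩
    rw [Set.indicator_of_mem hvB]
    refine (measure_mono fun x hx => ?_).trans ((h.volume_diff_translate_le hEm hE v).trans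
      (ENNReal.ofReal_le_ofReal ?_))
    · exact ⟨hx.1, hx.2.1⟩
    · gcongr
      exact norm_le_of_forall_abs_le hδ.le fun i => (hv i).le
  · have he : (fun x => (x, v)) ⁻¹' ((fun z : EuclideanSpace ℝ (Fin n) × EuclideanSpace ℝ (Fin n) =>
        (z.1, z.1 + z.2)) ⁻¹' T) = ∅ := by
      refine Set.eq_empty_of_forall_notMem fun x hx => hv fun i => ?_
      simpa using hx.2.2 i
    rw [he]
    simp

/-- The index of the cube of side `δ` that contains a point. -/
noncomputable def cubeIndex {n : ℕ} (δ : ℝ) (x : EuclideanSpace ℝ (Fin n)) : Fin n → ℤ :=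
  fun i => ⌊x i / δ⌋

theorem measurable_cubeIndex {n : ℕ} (δ : ℝ) :
    Measurable (cubeIndex δ : EuclideanSpace ℝ (Fin n) → Fin n → ℤ) := by
  refine measurable_pi_iff.2 fun i => Int.measurable_floor.comp ?_
  fun_prop

theorem cubeIndex_eq_iff {n : ℕ} {δ : ℝ} (hδ : 0 < δ) (x : EuclideanSpace ℝ (Fin n))
    (z : Fin n → ℤ) : cubeIndex δ x = z ↔ ∀ i, x i ∈ Set.Ico (z i * δ) (z i * δ + δ) := by
  rw [funext_iff]
  refine forall_congr' fun i => ?_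
  rw [cubeIndex, Int.floor_eq_iff, le_div_iff₀ hδ, div_lt_iff₀ hδ, add_mul, one_mul, Set.mem_Ico]

theorem volume_cubeIndex_preimage {n : ℕ} {δ : ℝ} (hδ : 0 < δ) (z : Fin n → ℤ) :
    volume ((cubeIndex δ : EuclideanSpace ℝ (Fin n) → Fin n → ℤ) ⁻¹' {z}) =
      ENNReal.ofReal δ ^ n := by
  rw [← volume_cube (fun i => z i * δ) δ]
  congr 1
  ext x
  exact cubeIndex_eq_iff hδ x z

theorem min_mul_add_le_two_mul (a b : ENNReal) : min a b * (a + b) ≤ 2 * (a * b) := by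
  rcases le_total a b with h | h
  · rw [min_eq_left h, mul_add, two_mul]
    gcongr
  · rw [min_eq_right h, mul_add, two_mul, mul_comm b a]
    gcongr

/-- A set of finite perimeter in the union of finitely many cubes is close to the union of those
cubes in which it has density at least one half. -/
theorem IsGaussGreen.exists_cubes {n : ℕ} {E : Set (EuclideanSpace ℝ (Fin n))}
    {μ : Measure (EuclideanSpace ℝ (Fin n))} {σ : EuclideanSpace ℝ (Fin n) → EuclideanSpace ℝ (Fin n)}
    (h : IsGaussGreen E μ σ) (hEm : MeasurableSet E) (hE : volume E ≠ ⊤) {δ : ℝ} (hδ : 0 < δ)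
    (Z : Finset (Fin n → ℤ)) (hZ : ∀ x ∈ E, cubeIndex δ x ∈ Z) :
    ∃ Z' ⊆ Z, volume (symmDiff E (cubeIndex δ ⁻¹' (Z' : Set (Fin n → ℤ)))) ≤
      ENNReal.ofReal (2 * 2 ^ n * (n * δ * μ.real Set.univ)) := by
  classical
  set Q : (Fin n → ℤ) → Set (EuclideanSpace ℝ (Fin n)) := fun z => cubeIndex δ ⁻¹' {z} with hQ
  have hQm : ∀ z, MeasurableSet (Q z) := fun z => measurable_cubeIndex δ (measurableSet_singleton z)
  refine ⟨Z.filter fun z => volume (Q z \ E) ≤ volume (Q z ∩ E), Finset.filter_subset _ _, ?_⟩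
  set N : Set (EuclideanSpace ℝ (Fin n)) := cubeIndex δ ⁻¹'
    (Z.filter fun z => volume (Q z \ E) ≤ volume (Q z ∩ E) : Finset (Fin n → ℤ)) with hN
  -- The majority rule leaves in each cube an error equal to the smaller of the two parts.
  have h1 : volume (symmDiff E N) ≤ ∑ z ∈ Z, min (volume (Q z ∩ E)) (volume (Q z \ E)) := by
    have hsub : symmDiff E N ⊆ ⋃ z ∈ Z,
        if volume (Q z \ E) ≤ volume (Q z ∩ E) then Q z \ E else Q z ∩ E := by
      rintro x (⟨hxE, hxN⟩ | ⟨hxN, hxE⟩)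
      · refine Set.mem_iUnion₂.2 ⟨cubeIndex δ x, hZ x hxE, ?_⟩
        rw [if_neg (fun hle => hxN (by simpa [hN] using ⟨hZ x hxE, hle⟩))]
        exact ⟨rfl, hxE⟩
      · have hx := Finset.mem_filter.1 (Finset.mem_coe.1 hxN)
        refine Set.mem_iUnion₂.2 ⟨cubeIndex δ x, hx.1, ?_⟩
        rw [if_pos hx.2]
        exact ⟨rfl, hxE⟩
    refine (measure_mono hsub).trans ((measure_biUnion_finset_le _ _).trans
      (Finset.sum_le_sum fun z _ => ?_))
    split_ifs with hz
    · rw [min_eq_right hz]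
    · rw [min_eq_left (not_le.1 hz).le]
  -- Each product is the measure of the pairs in one cube with first point in `E` and second
  -- outside. These sets are disjoint and consist of pairs closer than `δ` in every coordinate.
  have h2 : ∑ z ∈ Z, volume (Q z ∩ E) * volume (Q z \ E) ≤
      ENNReal.ofReal (n * δ * μ.real Set.univ) * ENNReal.ofReal (2 * δ) ^ n := by
    refine le_trans ?_ (h.volume_pairs_le hEm hE hδ)
    simp_rw [← Measure.prod_prod]
    rw [← measure_biUnion_finset]
    · refine measure_mono ?_
      intro p hp
      obtain ⟨z, -, hp1, hp2⟩ := Set.mem_iUnion₂.1 hp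
      refine ⟨hp1.2, hp2.2, fun i => ?_⟩
      have ha := (cubeIndex_eq_iff hδ p.1 z).1 hp1.1 i
      have hb := (cubeIndex_eq_iff hδ p.2 z).1 hp2.1 i
      rw [abs_lt]
      constructor <;> linarith [ha.1, ha.2, hb.1, hb.2]
    · intro z _ w _ hzw
      refine Set.disjoint_left.2 fun p hp hp' => hzw ?_
      exact (show cubeIndex δ p.1 = z from hp.1.1).symm.trans hp'.1.1
    · exact fun z _ => ((hQm z).inter hEm).prod ((hQm z).diff hEm)
  -- Multiplying by the cube volume, the sum of the two parts, turns minima into products; `(2 * δ)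
  -- ^ n` against `δ ^ n` leaves the factor `2 ^ n`.
  have h3 : volume (symmDiff E N) * ENNReal.ofReal δ ^ n ≤
      ENNReal.ofReal (2 * 2 ^ n * (n * δ * μ.real Set.univ)) * ENNReal.ofReal δ ^ n := by
    calc volume (symmDiff E N) * ENNReal.ofReal δ ^ n
        ≤ (∑ z ∈ Z, min (volume (Q z ∩ E)) (volume (Q z \ E))) * ENNReal.ofReal δ ^ n := by gcongr
      _ = ∑ z ∈ Z, min (volume (Q z ∩ E)) (volume (Q z \ E)) *
            (volume (Q z ∩ E) + volume (Q z \ E)) := by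
          rw [Finset.sum_mul]
          refine Finset.sum_congr rfl fun z _ => ?_
          rw [measure_inter_add_sdiff _ hEm, volume_cubeIndex_preimage hδ]
      _ ≤ ∑ z ∈ Z, 2 * (volume (Q z ∩ E) * volume (Q z \ E)) :=
          Finset.sum_le_sum fun z _ => min_mul_add_le_two_mul _ _
      _ ≤ 2 * (ENNReal.ofReal (n * δ * μ.real Set.univ) * ENNReal.ofReal (2 * δ) ^ n) := by
          rw [← Finset.mul_sum]
          gcongr
      _ = _ := by
          rw [ENNReal.ofReal_mul (p := 2 * 2 ^ n) (by positivity),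
            ENNReal.ofReal_mul (p := 2) (q := 2 ^ n) (by norm_num), ENNReal.ofReal_pow (by norm_num),
            ENNReal.ofReal_mul (p := 2) (q := δ) (by norm_num), mul_pow]
          simp only [ENNReal.ofReal_ofNat]
          ring
  exact (ENNReal.mul_le_mul_iff_left (pow_ne_zero _ (ENNReal.ofReal_pos.2 hδ).ne')
    (ENNReal.pow_ne_top ENNReal.ofReal_ne_top)).1 h3

/-- The sets of perimeter at most `C` in a ball are totally bounded for the distance
`|E Δ E'|`. -/
theorem exists_finite_net {n : ℕ} (R C : ℝ) {ε : ℝ} (hε : 0 < ε) :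
    ∃ 𝒩 : Set (Set (EuclideanSpace ℝ (Fin n))), 𝒩.Finite ∧ (∀ N ∈ 𝒩, MeasurableSet N) ∧
      ∀ E μ σ, IsGaussGreen E μ σ → MeasurableSet E → E ⊆ Metric.ball 0 R →
        μ.real Set.univ ≤ C → ∃ N ∈ 𝒩, volume (symmDiff E N) ≤ ENNReal.ofReal ε := by
  set A : ℝ := 2 * 2 ^ n * (n * max C 0) with hA
  have hA0 : 0 ≤ A := by positivity
  -- The error is at most `A * δ`; the added `1` covers `A = 0`.
  set δ : ℝ := ε / (A + 1) with hδ
  have hδ0 : 0 < δ := by positivity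
  set Z : Finset (Fin n → ℤ) := Fintype.piFinset fun _ => Finset.Icc (-⌈R / δ⌉) ⌈R / δ⌉
  refine ⟨(fun Z' : Finset (Fin n → ℤ) => cubeIndex δ ⁻¹' (Z' : Set (Fin n → ℤ))) '' Z.powerset,
    (Finset.finite_toSet _).image _, ?_, ?_⟩
  · rintro _ ⟨Z', -, rfl⟩
    exact measurable_cubeIndex δ Z'.finite_toSet.measurableSet
  intro E μ σ h hEm hER hμ
  have hEtop : volume E ≠ ⊤ := ((measure_mono hER).trans_lt measure_ball_lt_top).ne
  obtain ⟨Z', hZ', hle⟩ := h.exists_cubes hEm hEtop hδ0 Z (by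
    intro x hx
    refine Fintype.mem_piFinset.2 fun i => ?_
    have hxi : |x i| < R := (PiLp.norm_apply_le x i).trans_lt (by simpa using hER hx)
    have h1 : R / δ ≤ ⌈R / δ⌉ := Int.le_ceil _
    rw [div_le_iff₀ hδ0] at h1
    refine Finset.mem_Icc.2 ⟨Int.le_floor.2 ?_, Int.floor_le_iff.2 ?_⟩
    · rw [le_div_iff₀ hδ0]
      push_cast
      linarith [(abs_lt.1 hxi).1]
    · rw [div_lt_iff₀ hδ0]
      linarith [(abs_lt.1 hxi).2])
  refine ⟨_, ⟨Z', by simpa using hZ', rfl⟩, hle.trans (ENNReal.ofReal_le_ofReal ?_)⟩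
  calc 2 * 2 ^ n * (n * δ * μ.real Set.univ) ≤ 2 * 2 ^ n * (n * δ * max C 0) := by
        gcongr
        exact hμ.trans (le_max_left _ _)
    _ = A * δ := by rw [hA]; ring
    _ ≤ ε := by
        rw [hδ, ← mul_div_assoc, div_le_iff₀ (by positivity)]
        nlinarith

/-! ### Compactness of sets of bounded perimeter. -/

/-- The distance `|E Δ E'|` is complete along fast Cauchy sequences. -/
theorem exists_limit_set {α : Type*} [MeasurableSpace α] {ν : Measure α} {N : ℕ → Set α}
    (hN : ∀ j, MeasurableSet (N j))
    (h : ∀ j, ν (symmDiff (N j) (N (j + 1))) ≤ 2⁻¹ ^ j) :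
    ∃ S, MeasurableSet S ∧ ∀ j, ν (symmDiff (N j) S) ≤ 2 * 2⁻¹ ^ j := by
  refine ⟨⋂ j, ⋃ i, N (j + i), MeasurableSet.iInter fun j => MeasurableSet.iUnion fun i => hN _,
    fun j => ?_⟩
  -- The limit is the upper limit of the `N j`. A point whose membership never changes after index
  -- `j` lies in it exactly when it lies in `N j`.
  have hsub : symmDiff (N j) (⋂ j, ⋃ i, N (j + i)) ⊆
      ⋃ i, symmDiff (N (j + i)) (N (j + i + 1)) := by
    intro x hx
    by_contra hcon
    have hstep : ∀ i, x ∈ N (j + i + 1) ↔ x ∈ N (j + i) := by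
      intro i
      have : x ∉ symmDiff (N (j + i)) (N (j + i + 1)) := fun hi => hcon (Set.mem_iUnion.2 ⟨i, hi⟩)
      rw [Set.mem_symmDiff] at this
      tauto
    have hall : ∀ i, x ∈ N (j + i) ↔ x ∈ N j := by
      intro i
      induction i with
      | zero => rfl
      | succ i ih => rw [← add_assoc, hstep, ih]
    rcases hx with ⟨hx, hx'⟩ | ⟨hx, hx'⟩
    · refine hx' (Set.mem_iInter.2 fun k => Set.mem_iUnion.2 ⟨j, ?_⟩)
      rw [add_comm, hall]
      exact hx
    · obtain ⟨i, hi⟩ := Set.mem_iUnion.1 (Set.mem_iInter.1 hx j)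
      exact hx' ((hall i).1 hi)
  calc ν (symmDiff (N j) (⋂ j, ⋃ i, N (j + i)))
      ≤ ∑' i, ν (symmDiff (N (j + i)) (N (j + i + 1))) :=
        (measure_mono hsub).trans (measure_iUnion_le _)
    _ ≤ ∑' i, (2⁻¹ : ENNReal) ^ j * 2⁻¹ ^ i := by
        refine ENNReal.tsum_le_tsum fun i => ?_
        rw [← pow_add]
        exact h (j + i)
    _ = 2 * 2⁻¹ ^ j := by
        rw [ENNReal.tsum_mul_left, ENNReal.tsum_geometric, ENNReal.one_sub_inv_two, inv_inv, mul_comm]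

/-- Compactness of sets of bounded perimeter in a ball, along an ultrafilter. -/
theorem exists_tendsto_volume_symmDiff {n : ℕ} (𝒰 : Ultrafilter ℕ) {R C : ℝ}
    {E : ℕ → Set (EuclideanSpace ℝ (Fin n))} {μ : ℕ → Measure (EuclideanSpace ℝ (Fin n))}
    {σ : ℕ → EuclideanSpace ℝ (Fin n) → EuclideanSpace ℝ (Fin n)}
    (hE : ∀ k, IsGaussGreen (E k) (μ k) (σ k)) (hEm : ∀ k, NullMeasurableSet (E k))
    (hER : ∀ k, E k ⊆ Metric.ball 0 R) (hC : ∀ k, (μ k).real Set.univ ≤ C) :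
    ∃ S, MeasurableSet S ∧ S ⊆ Metric.ball 0 R ∧
      Tendsto (fun k => volume (symmDiff (E k) S)) 𝒰 (𝓝 0) := by
  have hnet : ∀ j : ℕ, ∃ N : Set (EuclideanSpace ℝ (Fin n)), MeasurableSet N ∧
      ∀ᶠ k in 𝒰, volume (symmDiff (E k) N) ≤ 2⁻¹ ^ (j + 1) := by
    intro j
    obtain ⟨𝒩, hfin, hmeas, hcov⟩ := exists_finite_net (n := n) R C
      (show (0 : ℝ) < 2⁻¹ ^ (j + 1) by positivity)
    have hex : ∀ᶠ k in 𝒰, ∃ N ∈ 𝒩, volume (symmDiff (E k) N) ≤ 2⁻¹ ^ (j + 1) := by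
      refine .of_forall fun k => ?_
      obtain ⟨E', hE'E, hE'm, hE'ae⟩ := (hEm k).exists_measurable_subset_ae_eq
      obtain ⟨N, hN, hle⟩ := hcov E' (μ k) (σ k) ((hE k).congr_ae hE'ae.symm) hE'm
        (hE'E.trans (hER k)) (hC k)
      refine ⟨N, hN, ?_⟩
      rw [measure_congr (hE'ae.symm.symmDiff (ae_eq_refl N))]
      refine hle.trans_eq ?_
      rw [ENNReal.ofReal_pow (by norm_num), ENNReal.ofReal_inv_of_pos (by norm_num)]
      simp
    -- Among finitely many alternatives an ultrafilter selects one. No diagonal subsequence is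
    -- needed.
    obtain ⟨N, hN, hev⟩ := (Ultrafilter.eventually_exists_mem_iff hfin).1 hex
    exact ⟨N, hmeas N hN, hev⟩
  choose N hNm hN using hnet
  have hhalf : ∀ j : ℕ, (2⁻¹ : ENNReal) ^ (j + 1) + 2⁻¹ ^ (j + 1) = 2⁻¹ ^ j := by
    intro j
    rw [pow_succ, ← mul_add, ENNReal.inv_two_add_inv_two, mul_one]
  obtain ⟨S, hSm, hS⟩ := exists_limit_set (ν := volume) hNm (by
    intro j
    -- Consecutive centres are close because a common `E k` is near both.
    obtain ⟨k, hk1, hk2⟩ := ((hN j).and (hN (j + 1))).exists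
    calc volume (symmDiff (N j) (N (j + 1)))
        ≤ volume (symmDiff (N j) (E k)) + volume (symmDiff (E k) (N (j + 1))) :=
          measure_symmDiff_le _ _ _
      _ ≤ 2⁻¹ ^ (j + 1) + 2⁻¹ ^ (j + 1 + 1) := by
          rw [symmDiff_comm (N j)]
          gcongr
      _ ≤ 2⁻¹ ^ (j + 1) + 2⁻¹ ^ (j + 1) := by
          exact add_le_add le_rfl (pow_le_pow_right_of_le_one' (by simp) (Nat.le_succ _))
      _ = 2⁻¹ ^ j := hhalf j)
  refine ⟨S ∩ Metric.ball 0 R, hSm.inter measurableSet_ball, Set.inter_subset_right, ?_⟩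
  have hbound : ∀ j : ℕ, ∀ᶠ k in 𝒰,
      volume (symmDiff (E k) (S ∩ Metric.ball 0 R)) ≤ 3 * 2⁻¹ ^ j := by
    intro j
    filter_upwards [hN j] with k hk
    have hsub : symmDiff (E k) (S ∩ Metric.ball 0 R) ⊆ symmDiff (E k) S := by
      intro x hx
      have := @hER k x
      simp only [Set.mem_symmDiff, Set.mem_inter_iff] at hx ⊢
      tauto
    calc volume (symmDiff (E k) (S ∩ Metric.ball 0 R))
        ≤ volume (symmDiff (E k) (N j)) + volume (symmDiff (N j) S) :=
          (measure_mono hsub).trans (measure_symmDiff_le _ _ _)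
      _ ≤ 2⁻¹ ^ j + 2 * 2⁻¹ ^ j := by
          gcongr
          · exact hk.trans (pow_le_pow_right_of_le_one' (by simp) (Nat.le_succ _))
          · exact hS j
      _ = 3 * 2⁻¹ ^ j := by ring
  have hlim : Tendsto (fun j : ℕ => 3 * (2⁻¹ : ENNReal) ^ j) atTop (𝓝 0) := by
    have := ENNReal.Tendsto.const_mul (a := 3)
      (ENNReal.tendsto_pow_atTop_nhds_zero_of_lt_one (r := 2⁻¹) (by simp)) (Or.inr (by simp))
    simpa using this
  refine ENNReal.tendsto_nhds_zero.2 fun ε hε => ?_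
  obtain ⟨j, hj⟩ := (hlim.eventually (gt_mem_nhds hε)).exists
  exact (hbound j).mono fun k hk => hk.trans hj.le

/-! ### Weak limits of measures and closure under convergence in measure. -/

theorem exists_tendsto_of_abs_le (𝒰 : Ultrafilter ℕ) {u : ℕ → ℝ} {M : ℝ} (h : ∀ k, |u k| ≤ M) :
    ∃ l, Tendsto u 𝒰 (𝓝 l) := by
  obtain ⟨l, -, hl⟩ := (isCompact_Icc (a := -M) (b := M)).ultrafilter_le_nhds' (𝒰.map u)
    (Ultrafilter.mem_map.2 (univ_mem' fun k => abs_le.1 (h k)))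
  exact ⟨l, hl⟩

open CompactlySupported in
/-- A bounded sequence of finite measures has a weak limit along an ultrafilter. -/
theorem exists_weak_limit {n : ℕ} (𝒰 : Ultrafilter ℕ) {ν : ℕ → Measure (EuclideanSpace ℝ (Fin n))}
    (hfin : ∀ k, IsFiniteMeasure (ν k)) {C : ℝ} (hC : ∀ k, (ν k).real Set.univ ≤ C) :
    ∃ ρ : Measure (EuclideanSpace ℝ (Fin n)), IsFiniteMeasure ρ ∧
      (∀ η : EuclideanSpace ℝ (Fin n) → ℝ, Continuous η → HasCompactSupport η →
        Tendsto (fun k => ∫ x, η x ∂(ν k)) 𝒰 (𝓝 (∫ x, η x ∂ρ))) ∧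
      ∀ C' : ℝ, (∀ᶠ k in 𝒰, (ν k).real Set.univ ≤ C') → ρ Set.univ ≤ ENNReal.ofReal C' := by
  have hint : ∀ (η : C_c(EuclideanSpace ℝ (Fin n), ℝ)) k, Integrable η (ν k) := fun η k =>
    η.continuous.integrable_of_hasCompactSupport η.hasCompactSupport
  have hlim : ∀ η : C_c(EuclideanSpace ℝ (Fin n), ℝ),
      ∃ l, Tendsto (fun k => ∫ x, η x ∂(ν k)) 𝒰 (𝓝 l) := by
    intro η
    obtain ⟨M, hM⟩ := η.continuous.bounded_above_of_compact_support η.hasCompactSupport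
    refine exists_tendsto_of_abs_le 𝒰 (M := M * C) fun k => ?_
    have hM0 : 0 ≤ M := (norm_nonneg _).trans (hM 0)
    rw [← Real.norm_eq_abs]
    exact (norm_integral_le_of_norm_le_const (.of_forall hM)).trans (by gcongr; exact hC k)
  choose L hL using hlim
  -- The ultrafilter limits of the integrals are linear and positive in `η`, hence represented by a
  -- measure.
  let Λ : C_c(EuclideanSpace ℝ (Fin n), ℝ) →ₚ[ℝ] ℝ := PositiveLinearMap.mk₀
    { toFun := L
      map_add' := fun η θ => tendsto_nhds_unique (hL (η + θ)) (((hL η).add (hL θ)).congr fun k => by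
        rw [← integral_add (hint η k) (hint θ k)]; rfl)
      map_smul' := fun c η => tendsto_nhds_unique (hL (c • η)) (((hL η).const_mul c).congr fun k => by
        rw [← integral_const_mul]; rfl) }
    (fun η hη => ge_of_tendsto' (hL η) fun k => integral_nonneg fun x => hη x)
  have hΛ : ∀ η : C_c(EuclideanSpace ℝ (Fin n), ℝ), Tendsto (fun k => ∫ x, η x ∂(ν k)) 𝒰
      (𝓝 (∫ x, η x ∂(RealRMK.rieszMeasure Λ))) := by
    intro η
    rw [RealRMK.integral_rieszMeasure]
    exact hL η
  have hmass : ∀ C' : ℝ, (∀ᶠ k in 𝒰, (ν k).real Set.univ ≤ C') →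
      RealRMK.rieszMeasure Λ Set.univ ≤ ENNReal.ofReal C' := by
    intro C' hC'
    rw [isOpen_univ.measure_eq_iSup_isCompact]
    refine iSup₂_le fun K _ => iSup_le fun hK => ?_
    obtain ⟨η, hη, hηc, hη1, -, hη01⟩ := exists_contDiff_bump hK isOpen_univ (Set.subset_univ K)
    let θ : C_c(EuclideanSpace ℝ (Fin n), ℝ) := ⟨⟨η, hη.continuous⟩, hηc⟩
    refine (RealRMK.rieszMeasure_le_of_eq_one Λ (f := θ) (fun x => (hη01 x).1) hK hη1).trans
      (ENNReal.ofReal_le_ofReal (le_of_tendsto (hL θ) (hC'.mono fun k hk => ?_)))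
    refine le_trans ?_ hk
    calc ∫ x, θ x ∂(ν k) ≤ ∫ _, (1 : ℝ) ∂(ν k) :=
          integral_mono (hint θ k) (integrable_const _) fun x => (hη01 x).2
      _ = (ν k).real Set.univ := by simp
  exact ⟨RealRMK.rieszMeasure Λ,
    ⟨(hmass C (.of_forall hC)).trans_lt ENNReal.ofReal_lt_top⟩,
    fun η hη hηc => hΛ ⟨⟨η, hη⟩, hηc⟩, hmass⟩

theorem abs_setIntegral_sub_le {n : ℕ} {ψ : EuclideanSpace ℝ (Fin n) → ℝ} {M : ℝ}
    (hψ : Integrable ψ) (hM : ∀ x, |ψ x| ≤ M) {E S : Set (EuclideanSpace ℝ (Fin n))}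
    (hE : NullMeasurableSet E) (hS : NullMeasurableSet S) (h : volume (symmDiff E S) ≠ ⊤) :
    |(∫ x in E, ψ x) - ∫ x in S, ψ x| ≤ M * volume.real (symmDiff E S) := by
  rw [← integral_indicator₀ hE, ← integral_indicator₀ hS,
    ← integral_sub (hψ.indicator₀ hE) (hψ.indicator₀ hS), ← Real.norm_eq_abs]
  have hES : NullMeasurableSet (symmDiff E S) := (hE.diff hS).union (hS.diff hE)
  calc ‖∫ x, (E.indicator ψ x - S.indicator ψ x)‖
      ≤ ∫ x, (symmDiff E S).indicator (fun _ => M) x := by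
        refine norm_integral_le_of_norm_le
          ((integrableOn_const h).integrable_indicator₀ hES) (.of_forall fun x => ?_)
        have hx := hM x
        by_cases h1 : x ∈ E <;> by_cases h2 : x ∈ S <;>
          simp [h1, h2, Set.mem_symmDiff, hx]
    _ = M * volume.real (symmDiff E S) := by
        rw [integral_indicator₀ hES, setIntegral_const, smul_eq_mul, mul_comm]

theorem tendsto_setIntegral_of_symmDiff {n : ℕ} {l : Filter ℕ} {ψ : EuclideanSpace ℝ (Fin n) → ℝ}
    (hψ : Continuous ψ) (hc : HasCompactSupport ψ) {E : ℕ → Set (EuclideanSpace ℝ (Fin n))}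
    {S : Set (EuclideanSpace ℝ (Fin n))} (hE : ∀ k, NullMeasurableSet (E k))
    (hS : NullMeasurableSet S) (h : Tendsto (fun k => volume (symmDiff (E k) S)) l (𝓝 0)) :
    Tendsto (fun k => ∫ x in E k, ψ x) l (𝓝 (∫ x in S, ψ x)) := by
  obtain ⟨M, hM⟩ := hψ.bounded_above_of_compact_support hc
  have h0 : Tendsto (fun k => M * volume.real (symmDiff (E k) S)) l (𝓝 0) := by
    simpa [Measure.real, Function.comp_def] using ((ENNReal.tendsto_toReal ENNReal.zero_ne_top).comp h).const_mul M
  refine tendsto_iff_norm_sub_tendsto_zero.2 (squeeze_zero' (.of_forall fun k => norm_nonneg _) ?_ h0)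
  filter_upwards [h.eventually (gt_mem_nhds ENNReal.zero_lt_top)] with k hk
  exact abs_setIntegral_sub_le (hψ.integrable_of_hasCompactSupport hc) hM (hE k) hS hk.ne

/-- Polar decomposition of a vector measure that is given by its components. -/
theorem exists_polar {n : ℕ} (κ : Fin n → Measure (EuclideanSpace ℝ (Fin n)))
    (ρ : Measure (EuclideanSpace ℝ (Fin n))) (hκ : ∀ i, IsFiniteMeasure (κ i)) [IsFiniteMeasure ρ] :
    ∃ (μ : Measure (EuclideanSpace ℝ (Fin n)))
      (σ : EuclideanSpace ℝ (Fin n) → EuclideanSpace ℝ (Fin n)),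
      IsFiniteMeasure μ ∧ Measurable σ ∧ (∀ᵐ x ∂μ, ‖σ x‖ = 1) ∧
      ∀ φ : EuclideanSpace ℝ (Fin n) → EuclideanSpace ℝ (Fin n), Continuous φ →
        HasCompactSupport φ →
        ∫ x, inner ℝ (φ x) (σ x) ∂μ = ∑ i, ((∫ x, φ x i ∂(κ i)) - ∫ x, φ x i ∂ρ) := by
  set τ : Measure (EuclideanSpace ℝ (Fin n)) := ρ + ∑ i, κ i with hτ
  have : IsFiniteMeasure τ := by
    refine ⟨?_⟩
    rw [hτ, Measure.add_apply, Measure.finsetSum_apply]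
    exact ENNReal.add_lt_top.2 ⟨measure_lt_top _ _,
      ENNReal.sum_lt_top.2 fun i _ => measure_lt_top _ _⟩
  have hρτ : ρ ≪ τ := Measure.absolutelyContinuous_of_le (Measure.le_add_right le_rfl)
  have hκτ : ∀ i, κ i ≪ τ := fun i => Measure.absolutelyContinuous_of_le
    (Measure.le_add_left (Finset.single_le_sum (f := κ) (fun _ _ => Measure.zero_le _)
      (Finset.mem_univ i)))
  -- `d` is the density of the vector measure with components `κ i - ρ` relative to the dominating
  -- `τ`. The polar pair is `‖d‖ τ` and `d / ‖d‖`; zeros of `d` are null for the former.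
  let d : EuclideanSpace ℝ (Fin n) → EuclideanSpace ℝ (Fin n) := fun x =>
    WithLp.toLp 2 fun i => ((κ i).rnDeriv τ x).toReal - (ρ.rnDeriv τ x).toReal
  have hdi : ∀ i, Integrable (fun x => d x i) τ := fun i =>
    Measure.integrable_toReal_rnDeriv.sub Measure.integrable_toReal_rnDeriv
  have hdm : Measurable d := by
    refine (WithLp.measurable_toLp 2 _).comp (measurable_pi_iff.2 fun i => ?_)
    exact (Measure.measurable_rnDeriv _ _).ennreal_toReal.sub
      (Measure.measurable_rnDeriv _ _).ennreal_toReal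
  have hd : Integrable d τ := Integrable.of_eval_piLp hdi
  refine ⟨τ.withDensity fun x => ‖d x‖ₑ, fun x => ‖d x‖⁻¹ • d x,
    isFiniteMeasure_withDensity hd.2.ne, hdm.norm.inv.smul hdm, ?_, ?_⟩
  · rw [ae_withDensity_iff hdm.enorm]
    refine .of_forall fun x hx => ?_
    have : ‖d x‖ ≠ 0 := by simpa using hx
    rw [norm_smul, norm_inv, norm_norm, inv_mul_cancel₀ this]
  · intro φ hφ hφc
    rw [integral_withDensity_eq_integral_toReal_smul hdm.enorm (by simp)]
    have h1 : ∀ x, (‖d x‖ₑ).toReal • inner ℝ (φ x) (‖d x‖⁻¹ • d x) = ∑ i, d x i * φ x i := by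
      intro x
      rw [toReal_enorm, inner_smul_right, smul_eq_mul, ← mul_assoc]
      rcases eq_or_ne (d x) 0 with h0 | h0
      · simp [h0]
      · rw [mul_inv_cancel₀ (norm_ne_zero_iff.2 h0), one_mul, PiLp.inner_apply]
        simp
    have hφi : ∀ i, Continuous fun x => φ x i := fun i => by fun_prop
    have hφb : ∀ i, ∃ M, ∀ x, ‖φ x i‖ ≤ M := fun i =>
      (hφi i).bounded_above_of_compact_support 
        (hφc.comp_left (g := fun y : EuclideanSpace ℝ (Fin n) => y i) rfl)
    have hib : ∀ i {u : EuclideanSpace ℝ (Fin n) → ℝ}, Integrable u τ →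
        Integrable (fun x => u x * φ x i) τ := by
      intro i u hu
      obtain ⟨M, hM⟩ := hφb i
      exact hu.mul_bdd (hφi i).aestronglyMeasurable (.of_forall hM)
    simp_rw [h1]
    rw [integral_finsetSum _ fun i _ => hib i (hdi i)]
    refine Finset.sum_congr rfl fun i _ => ?_
    have hκi := hκ i
    have hτs : SigmaFinite τ := inferInstance
    have hκd : (κ i).HaveLebesgueDecomposition τ :=
      Measure.haveLebesgueDecomposition_of_sigmaFinite _ _
    rw [← integral_toReal_rnDeriv_mul (hκτ i), ← integral_toReal_rnDeriv_mul hρτ, ← integral_sub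
      (hib i Measure.integrable_toReal_rnDeriv) (hib i Measure.integrable_toReal_rnDeriv)]
    refine integral_congr_ae (.of_forall fun x => ?_)
    simp only [d]
    ring

theorem continuous_divergence {n : ℕ} {φ : EuclideanSpace ℝ (Fin n) → EuclideanSpace ℝ (Fin n)}
    (hφ : ContDiff ℝ 1 φ) : Continuous (divergence φ) := by
  have h := hφ.continuous_fderiv one_ne_zero
  unfold divergence
  fun_prop

theorem hasCompactSupport_divergence {n : ℕ}
    {φ : EuclideanSpace ℝ (Fin n) → EuclideanSpace ℝ (Fin n)} (hc : HasCompactSupport φ) :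
    HasCompactSupport (divergence φ) := by
  refine (hc.fderiv (𝕜 := ℝ)).mono fun x hx => ?_
  contrapose! hx
  simp only [Function.mem_support, not_not] at hx ⊢
  simp [divergence, hx]

/-- Sets of bounded perimeter that converge in measure have a limit of finite perimeter. -/
theorem exists_isGaussGreen_limit {n : ℕ} (𝒰 : Ultrafilter ℕ) {C : ℝ}
    {E : ℕ → Set (EuclideanSpace ℝ (Fin n))} {μ : ℕ → Measure (EuclideanSpace ℝ (Fin n))}
    {σ : ℕ → EuclideanSpace ℝ (Fin n) → EuclideanSpace ℝ (Fin n)}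
    (hE : ∀ k, IsGaussGreen (E k) (μ k) (σ k)) (hEm : ∀ k, NullMeasurableSet (E k))
    (hC : ∀ k, (μ k).real Set.univ ≤ C) {S : Set (EuclideanSpace ℝ (Fin n))}
    (hS : NullMeasurableSet S) (h : Tendsto (fun k => volume (symmDiff (E k) S)) 𝒰 (𝓝 0)) :
    ∃ ν τ, IsGaussGreen S ν τ := by
  have hfin : ∀ k, IsFiniteMeasure (μ k) := fun k => (hE k).finite
  obtain ⟨ρ, hρ, hρlim, -⟩ := exists_weak_limit 𝒰 hfin hC
  have hσm : ∀ k i, Measurable fun x => σ k x i := fun k i => by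
    have := (hE k).measurable
    fun_prop
  have hσ1 : ∀ k i, ∀ᵐ x ∂(μ k), |σ k x i| ≤ 1 := fun k i =>
    (hE k).norm_eq_one.mono fun x hx => (PiLp.norm_apply_le (σ k x) i).trans_eq hx
  -- Adding `1` to each component of `σ k` makes it nonnegative almost everywhere, so weak limits of
  -- positive measures suffice; the limit `ρ` of the `μ k` is subtracted afterwards.
  let κ : Fin n → ℕ → Measure (EuclideanSpace ℝ (Fin n)) := fun i k =>
    (μ k).withDensity fun x => ENNReal.ofReal (1 + σ k x i)
  have hκle : ∀ i k, κ i k Set.univ ≤ 2 * μ k Set.univ := by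
    intro i k
    rw [withDensity_apply _ MeasurableSet.univ, Measure.restrict_univ, ← lintegral_const]
    refine lintegral_mono_ae ((hσ1 k i).mono fun x hx => ?_)
    exact ENNReal.ofReal_le_of_le_toReal (by
      have := (abs_le.1 hx).2
      simp only [ENNReal.toReal_ofNat]
      linarith)
  have hκtop : ∀ k, 2 * μ k Set.univ ≠ ⊤ := fun k =>
    ENNReal.mul_ne_top (by simp) (measure_ne_top _ _)
  have hκfin : ∀ i k, IsFiniteMeasure (κ i k) := fun i k =>
    ⟨(hκle i k).trans_lt (hκtop k).lt_top⟩
  have hκC : ∀ i k, (κ i k).real Set.univ ≤ 2 * C := by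
    intro i k
    refine (ENNReal.toReal_mono (hκtop k) (hκle i k)).trans ?_
    rw [ENNReal.toReal_mul, ENNReal.toReal_ofNat]
    have := hC k
    rw [Measure.real] at this
    linarith
  have hκint : ∀ i k (η : EuclideanSpace ℝ (Fin n) → ℝ), Integrable η (μ k) →
      (∫ x, η x ∂(κ i k)) - ∫ x, η x ∂(μ k) = ∫ x, η x * σ k x i ∂(μ k) := by
    intro i k η hη
    have hprod : Integrable (fun x => η x * σ k x i) (μ k) :=
      hη.mul_bdd (c := 1) (hσm k i).aestronglyMeasurable (hσ1 k i)
    rw [integral_withDensity_eq_integral_toReal_smul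
      (((hσm k i).const_add 1).ennreal_ofReal) (by simp), sub_eq_iff_eq_add', ← integral_add hη hprod]
    refine integral_congr_ae ((hσ1 k i).mono fun x hx => ?_)
    simp only [smul_eq_mul]
    rw [ENNReal.toReal_ofReal (by linarith [(abs_le.1 hx).1])]
    ring
  choose κ' hκ' hκlim _ using fun i => exists_weak_limit 𝒰 (hκfin i) (hκC i)
  obtain ⟨ν, τ, hν, hτm, hτ1, hint⟩ := exists_polar κ' ρ hκ'
  refine ⟨ν, τ, hν, hτm, hτ1, fun φ hφ hφc => ?_⟩
  have hφi : ∀ i, Continuous fun x => φ x i := fun i => by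
    have := hφ.continuous
    fun_prop
  have hφic : ∀ i, HasCompactSupport fun x => φ x i := fun i =>
    hφc.comp_left (g := fun y : EuclideanSpace ℝ (Fin n) => y i) rfl
  rw [hint φ hφ.continuous hφc]
  refine tendsto_nhds_unique (tendsto_setIntegral_of_symmDiff (continuous_divergence hφ)
    (hasCompactSupport_divergence hφc) hEm hS h) ?_
  refine (tendsto_finsetSum Finset.univ fun i _ => (hκlim i _ (hφi i) (hφic i)).sub
    (hρlim _ (hφi i) (hφic i))).congr fun k => ?_
  have hi : ∀ i, Integrable (fun x => φ x i) (μ k) := fun i =>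
    (hφi i).integrable_of_hasCompactSupport (hφic i)
  rw [(hE k).integral_div φ hφ hφc, Finset.sum_congr rfl fun i _ => hκint i k _ (hi i),
    ← integral_finsetSum _ fun i _ =>
      (hi i).mul_bdd (c := 1) (hσm k i).aestronglyMeasurable (hσ1 k i)]
  refine integral_congr_ae (.of_forall fun x => ?_)
  simp [PiLp.inner_apply, mul_comm]

/-! ### Lower semicontinuity of the surface energy. -/

/-- Supporting functionals at a dense set of points `w` suffice: the one at `w` falls short of `f v`
by at most `f v - f w + f (w - v)`, which is small for `w` near `v`. Countability permits the
measurable partition used next. -/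
theorem IsSurfaceTension.exists_countable_support {n : ℕ} {f : EuclideanSpace ℝ (Fin n) → ℝ}
    (hf : IsSurfaceTension f) : ∃ a : ℕ → EuclideanSpace ℝ (Fin n),
      (∀ j w, inner ℝ (a j) w ≤ f w) ∧ ∀ v, ∀ ε > 0, ∃ j, f v - ε ≤ inner ℝ (a j) v := by
  choose b hb1 hb2 using hf.exists_inner_eq
  refine ⟨fun j => b (TopologicalSpace.denseSeq _ j), fun j w => hb1 _ w, fun v ε hε => ?_⟩
  have hopen : IsOpen {w | f v - f w + f (w - v) < ε} :=
    isOpen_lt ((continuous_const.sub hf.continuous).add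
      (hf.continuous.comp (continuous_id.sub continuous_const))) continuous_const
  obtain ⟨_, hw, j, rfl⟩ := (TopologicalSpace.denseRange_denseSeq
    (EuclideanSpace ℝ (Fin n))).inter_open_nonempty _ hopen ⟨v, by simpa [hf.map_zero] using hε⟩
  refine ⟨j, ?_⟩
  set w := TopologicalSpace.denseSeq (EuclideanSpace ℝ (Fin n)) j
  have h1 := hb1 w (w - v)
  rw [inner_sub_right, hb2] at h1
  have hw' : f v - f w + f (w - v) < ε := hw
  linarith

/-- If the component of a vector measure in every direction of the closed Wulff shape is at most
`ρ`, then the total anisotropic variation is at most the mass of `ρ`. -/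
theorem IsSurfaceTension.lintegral_le_of_forall_withDensity_le {n : ℕ}
    {f : EuclideanSpace ℝ (Fin n) → ℝ} (hf : IsSurfaceTension f)
    {μ ρ : Measure (EuclideanSpace ℝ (Fin n))} [IsFiniteMeasure μ]
    {σ : EuclideanSpace ℝ (Fin n) → EuclideanSpace ℝ (Fin n)} (hσ : Measurable σ)
    (h : ∀ a, (∀ w, inner ℝ a w ≤ f w) →
      μ.withDensity (fun x => ENNReal.ofReal (inner ℝ a (σ x))) ≤
        ρ + μ.withDensity fun x => ENNReal.ofReal (-inner ℝ a (σ x))) :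
    ∫⁻ x, ENNReal.ofReal (f (σ x)) ∂μ ≤ ρ Set.univ := by
  obtain ⟨a, ha, hdense⟩ := hf.exists_countable_support
  have hfm : Measurable fun x => f (σ x) := hf.continuous.measurable.comp hσ
  have ham : ∀ j, Measurable fun x => inner ℝ (a j) (σ x) := fun j =>
    (continuous_const.inner continuous_id).measurable.comp hσ
  have key : ∀ ε : ℝ, 0 < ε → ∫⁻ x, ENNReal.ofReal (f (σ x)) ∂μ ≤
      ρ Set.univ + ENNReal.ofReal (2 * ε) * μ Set.univ := by
    intro ε hε
    -- Space is partitioned according to which `a j` nearly attains `f (σ x)`. On a piece the linear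
    -- term costs one `ε`, and its negative part, at most `ε` because `0 ≤ f`, costs the other.
    let A : ℕ → Set (EuclideanSpace ℝ (Fin n)) := fun j => {x | f (σ x) - ε ≤ inner ℝ (a j) (σ x)}
    have hAm : ∀ j, MeasurableSet (A j) := fun j =>
      measurableSet_le (hfm.sub_const ε) (ham j)
    have hBm : ∀ j, MeasurableSet (disjointed A j) := fun j => MeasurableSet.disjointed hAm j
    have hcov : ⋃ j, disjointed A j = Set.univ := by
      rw [iUnion_disjointed]
      exact Set.eq_univ_of_forall fun x => Set.mem_iUnion.2 (hdense (σ x) ε hε)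
    have hloc : ∀ j, ∫⁻ x in disjointed A j, ENNReal.ofReal (f (σ x)) ∂μ ≤
        ρ (disjointed A j) + ENNReal.ofReal (2 * ε) * μ (disjointed A j) := by
      intro j
      have hA : ∀ x ∈ disjointed A j, f (σ x) - ε ≤ inner ℝ (a j) (σ x) :=
        fun x hx => disjointed_subset A j hx
      calc ∫⁻ x in disjointed A j, ENNReal.ofReal (f (σ x)) ∂μ
          ≤ ∫⁻ x in disjointed A j, (ENNReal.ofReal (inner ℝ (a j) (σ x)) + ENNReal.ofReal ε) ∂μ := by
            refine setLIntegral_mono' (hBm j) fun x hx => ?_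
            refine le_trans (ENNReal.ofReal_le_ofReal ?_) ENNReal.ofReal_add_le
            linarith [hA x hx]
        _ = μ.withDensity (fun x => ENNReal.ofReal (inner ℝ (a j) (σ x))) (disjointed A j)
              + ENNReal.ofReal ε * μ (disjointed A j) := by
            rw [lintegral_add_right _ measurable_const, setLIntegral_const,
              withDensity_apply _ (hBm j)]
        _ ≤ (ρ (disjointed A j) + ENNReal.ofReal ε * μ (disjointed A j))
              + ENNReal.ofReal ε * μ (disjointed A j) := by
            gcongr
            refine (h (a j) (ha j) _).trans ?_
            rw [Measure.add_apply]
            gcongr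
            rw [withDensity_apply _ (hBm j), ← setLIntegral_const]
            refine setLIntegral_mono' (hBm j) fun x hx => ENNReal.ofReal_le_ofReal ?_
            linarith [hA x hx, hf.nonneg (σ x)]
        _ = ρ (disjointed A j) + ENNReal.ofReal (2 * ε) * μ (disjointed A j) := by
            rw [two_mul, ENNReal.ofReal_add hε.le hε.le]
            ring
    calc ∫⁻ x, ENNReal.ofReal (f (σ x)) ∂μ
        = ∑' j, ∫⁻ x in disjointed A j, ENNReal.ofReal (f (σ x)) ∂μ := by
          rw [← lintegral_iUnion hBm (disjoint_disjointed A), hcov, Measure.restrict_univ]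
      _ ≤ ∑' j, (ρ (disjointed A j) + ENNReal.ofReal (2 * ε) * μ (disjointed A j)) :=
          ENNReal.tsum_le_tsum hloc
      _ = ρ Set.univ + ENNReal.ofReal (2 * ε) * μ Set.univ := by
          rw [ENNReal.tsum_add, ENNReal.tsum_mul_left,
            ← measure_iUnion (disjoint_disjointed A) hBm,
            ← measure_iUnion (disjoint_disjointed A) hBm, hcov]
  have hlim : Tendsto (fun ε : ℝ => ρ Set.univ + ENNReal.ofReal (2 * ε) * μ Set.univ) (𝓝[>] 0)
      (𝓝 (ρ Set.univ)) := by
    have h1 : Tendsto (fun ε : ℝ => ENNReal.ofReal (2 * ε)) (𝓝[>] 0) (𝓝 0) := by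
      have : Continuous fun ε : ℝ => ENNReal.ofReal (2 * ε) :=
        ENNReal.continuous_ofReal.comp (continuous_const.mul continuous_id)
      simpa using (this.tendsto 0).mono_left nhdsWithin_le_nhds
    simpa using tendsto_const_nhds.add
      (ENNReal.Tendsto.mul_const h1 (Or.inr (measure_ne_top μ Set.univ)))
  exact ge_of_tendsto hlim (eventually_mem_nhdsWithin.mono fun ε hε => key ε hε)

/-- Lower semicontinuity of the surface energy along sets of bounded perimeter that converge in
measure. -/
theorem IsSurfaceTension.lintegral_le_of_tendsto {n : ℕ} {f : EuclideanSpace ℝ (Fin n) → ℝ}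
    (hf : IsSurfaceTension f) (𝒰 : Ultrafilter ℕ) {C : ℝ}
    {E : ℕ → Set (EuclideanSpace ℝ (Fin n))} {μ : ℕ → Measure (EuclideanSpace ℝ (Fin n))}
    {σ : ℕ → EuclideanSpace ℝ (Fin n) → EuclideanSpace ℝ (Fin n)}
    (hE : ∀ k, IsGaussGreen (E k) (μ k) (σ k)) (hEm : ∀ k, NullMeasurableSet (E k))
    (hC : ∀ k, ∫⁻ x, ENNReal.ofReal (f (σ k x)) ∂(μ k) ≤ ENNReal.ofReal C)
    {S : Set (EuclideanSpace ℝ (Fin n))} (hS : NullMeasurableSet S)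
    (h : Tendsto (fun k => volume (symmDiff (E k) S)) 𝒰 (𝓝 0))
    {ν : Measure (EuclideanSpace ℝ (Fin n))} {τ : EuclideanSpace ℝ (Fin n) → EuclideanSpace ℝ (Fin n)}
    (hSτ : IsGaussGreen S ν τ) {C' : ℝ} (hC'0 : 0 ≤ C')
    (hC' : ∀ᶠ k in 𝒰, ∫⁻ x, ENNReal.ofReal (f (σ k x)) ∂(μ k) ≤ ENNReal.ofReal C') :
    ∫⁻ x, ENNReal.ofReal (f (τ x)) ∂ν ≤ ENNReal.ofReal C' := by
  have hfin : ∀ k, IsFiniteMeasure (μ k) := fun k => (hE k).finite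
  have hνfin := hSτ.finite
  have hfm : ∀ k, Measurable fun x => f (σ k x) := fun k =>
    hf.continuous.measurable.comp (hE k).measurable
  have hint : ∀ k, Integrable (fun x => f (σ k x)) (μ k) := fun k =>
    (lintegral_ofReal_ne_top_iff_integrable (hfm k).aestronglyMeasurable
      (.of_forall fun x => hf.nonneg _)).1 ((hC k).trans_lt ENNReal.ofReal_lt_top).ne
  -- `θ k` is the surface energy as a measure. Its weak limit `ρ` will dominate every component `⟨a,
  -- τ⟩ ν` with `⟨a, ·⟩ ≤ f`.
  let θ : ℕ → Measure (EuclideanSpace ℝ (Fin n)) := fun k =>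
    (μ k).withDensity fun x => ENNReal.ofReal (f (σ k x))
  have hθuniv : ∀ k, θ k Set.univ = ∫⁻ x, ENNReal.ofReal (f (σ k x)) ∂(μ k) := fun k => by
    rw [withDensity_apply _ MeasurableSet.univ, Measure.restrict_univ]
  have hθfin : ∀ k, IsFiniteMeasure (θ k) := fun k =>
    ⟨by rw [hθuniv]; exact (hC k).trans_lt ENNReal.ofReal_lt_top⟩
  obtain ⟨ρ, hρ, hρlim, hρmass⟩ := exists_weak_limit 𝒰 hθfin (C := max C 0) fun k =>
    ENNReal.toReal_le_of_le_ofReal (le_max_right _ _) ((hθuniv k).trans_le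
      ((hC k).trans (ENNReal.ofReal_le_ofReal (le_max_left _ _))))
  refine le_trans ?_ (hρmass C' (hC'.mono fun k hk =>
    ENNReal.toReal_le_of_le_ofReal hC'0 ((hθuniv k).trans_le hk)))
  refine hf.lintegral_le_of_forall_withDensity_le hSτ.measurable fun a ha => ?_
  have ham : Measurable fun x => inner ℝ a (τ x) :=
    (continuous_const.inner continuous_id).measurable.comp hSτ.measurable
  have hnm : Measurable fun x => -inner ℝ a (τ x) := ham.neg
  have hai : Integrable (fun x => inner ℝ a (τ x)) ν := hSτ.integrable.const_inner a
  have hni : Integrable (fun x => -inner ℝ a (τ x)) ν := hai.neg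
  have hp : IsFiniteMeasure (ν.withDensity fun x => ENNReal.ofReal (inner ℝ a (τ x))) :=
    isFiniteMeasure_withDensity_ofReal hai.2
  have hm : IsFiniteMeasure (ν.withDensity fun x => ENNReal.ofReal (-inner ℝ a (τ x))) :=
    isFiniteMeasure_withDensity_ofReal hni.2
  refine measure_le_of_forall_integral_le fun η hη hηc hη0 => ?_
  have hηi : ∀ (π : Measure (EuclideanSpace ℝ (Fin n))) [IsFiniteMeasure π], Integrable η π :=
    fun π _ => hη.continuous.integrable_of_hasCompactSupport hηc
  have hle : ∫ x, η x * inner ℝ a (τ x) ∂ν ≤ ∫ x, η x ∂ρ := by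
    have hl : Tendsto (fun k => ∫ x, η x * inner ℝ a (σ k x) ∂(μ k)) 𝒰
        (𝓝 (∫ x, η x * inner ℝ a (τ x) ∂ν)) := by
      -- By Gauss-Green both sides are volume integrals of a fixed function, so convergence in
      -- measure suffices.
      simp_rw [← fun k => (hE k).integral_fderiv hη hηc a, ← hSτ.integral_fderiv hη hηc a]
      exact tendsto_setIntegral_of_symmDiff
        ((hη.continuous_fderiv one_ne_zero).clm_apply continuous_const)
        (hηc.fderiv_apply (𝕜 := ℝ) a) hEm hS h
    refine le_of_tendsto_of_tendsto' hl (hρlim η hη.continuous hηc) fun k => ?_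
    rw [integral_withDensity_eq_integral_toReal_smul (hfm k).ennreal_ofReal (by simp)]
    obtain ⟨M, hM⟩ := hη.continuous.bounded_above_of_compact_support hηc
    refine integral_mono (((hE k).integrable.const_inner a).bdd_mul
        hη.continuous.aestronglyMeasurable (.of_forall hM)) ?_ fun x => ?_
    · simp_rw [ENNReal.toReal_ofReal (hf.nonneg _), smul_eq_mul]
      exact (hint k).mul_bdd hη.continuous.aestronglyMeasurable (.of_forall hM)
    · simp only [ENNReal.toReal_ofReal (hf.nonneg _), smul_eq_mul]
      rw [mul_comm (f _)]
      exact mul_le_mul_of_nonneg_left (ha _) (hη0 x)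
  obtain ⟨M, hM⟩ := hη.continuous.bounded_above_of_compact_support hηc
  rw [integral_add_measure (hηi _) (hηi _), ← sub_le_iff_le_add]
  refine le_trans (le_of_eq ?_) hle
  have hb : ∀ {u : EuclideanSpace ℝ (Fin n) → ℝ}, Integrable u ν →
      Integrable (fun x => (ENNReal.ofReal (u x)).toReal • η x) ν := fun hu =>
    hu.real_toNNReal.mul_bdd hη.continuous.aestronglyMeasurable (.of_forall hM)
  rw [integral_withDensity_eq_integral_toReal_smul ham.ennreal_ofReal (by simp),
    integral_withDensity_eq_integral_toReal_smul hnm.ennreal_ofReal (by simp),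
    ← integral_sub (hb hai) (hb hni)]
  refine integral_congr_ae (.of_forall fun x => ?_)
  simp only [ENNReal.toReal_ofReal', smul_eq_mul]
  rcases le_total 0 (inner ℝ a (τ x)) with h0 | h0
  · rw [max_eq_left h0, max_eq_right (by linarith)]; ring
  · rw [max_eq_right h0, max_eq_left (by linarith)]; ring

/-! ### Control of the perimeter by the surface energy. -/

/-- The Gauss-Green measure of a bounded set has total mass zero. -/
theorem IsGaussGreen.integral_inner_eq_zero {n : ℕ} {E : Set (EuclideanSpace ℝ (Fin n))}
    {μ : Measure (EuclideanSpace ℝ (Fin n))} {σ : EuclideanSpace ℝ (Fin n) → EuclideanSpace ℝ (Fin n)}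
    (h : IsGaussGreen E μ σ) {R : ℝ} (hER : E ⊆ Metric.ball 0 R) (a : EuclideanSpace ℝ (Fin n)) :
    ∫ x, inner ℝ a (σ x) ∂μ = 0 := by
  have := h.finite
  -- The cutoffs equal one on balls containing `E`, so their derivatives vanish on `E`; dominated
  -- convergence removes them.
  choose η hη hηc hη1 _ hη01 using fun k : ℕ => exists_contDiff_bump
    (isCompact_closedBall (0 : EuclideanSpace ℝ (Fin n)) (R + k)) isOpen_univ (Set.subset_univ _)
  have hzero : ∀ k, ∫ x, η k x * inner ℝ a (σ x) ∂μ = 0 := by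
    intro k
    rw [← h.integral_fderiv (hη k) (hηc k) a]
    refine setIntegral_eq_zero_of_forall_eq_zero fun x hx => ?_
    have hev : η k =ᶠ[𝓝 x] fun _ => 1 := by
      filter_upwards [Metric.isOpen_ball.mem_nhds (hER hx)] with y hy
      refine hη1 k y (Metric.ball_subset_closedBall (Metric.ball_subset_ball ?_ hy))
      linarith [Nat.cast_nonneg (α := ℝ) k]
    rw [hev.fderiv_eq]
    simp
  have ha : Integrable (fun x => inner ℝ a (σ x)) μ := h.integrable.const_inner a
  have hlim : Tendsto (fun k => ∫ x, η k x * inner ℝ a (σ x) ∂μ) atTop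
      (𝓝 (∫ x, inner ℝ a (σ x) ∂μ)) := by
    refine tendsto_integral_of_dominated_convergence (fun x => ‖inner ℝ a (σ x)‖)
      (fun k => (hη k).continuous.aestronglyMeasurable.mul ha.1) ha.norm
      (fun k => .of_forall fun x => ?_) (.of_forall fun x => ?_)
    · rw [norm_mul, Real.norm_eq_abs, abs_of_nonneg (hη01 k x).1]
      exact mul_le_of_le_one_left (norm_nonneg _) (hη01 k x).2
    · refine tendsto_const_nhds.congr' ?_
      obtain ⟨K, hK⟩ := exists_nat_ge (‖x‖ - R)
      filter_upwards [eventually_ge_atTop K] with k hk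
      have hKk : (K : ℝ) ≤ k := by exact_mod_cast hk
      rw [hη1 k x (by rw [mem_closedBall_zero_iff]; linarith), one_mul]
  exact tendsto_nhds_unique hlim (by simp only [hzero]; exact tendsto_const_nhds)

theorem IsGaussGreen.lintegral_ne_top {n : ℕ} {E : Set (EuclideanSpace ℝ (Fin n))}
    {μ : Measure (EuclideanSpace ℝ (Fin n))} {σ : EuclideanSpace ℝ (Fin n) → EuclideanSpace ℝ (Fin n)}
    (h : IsGaussGreen E μ σ) {f : EuclideanSpace ℝ (Fin n) → ℝ} (hf : IsSurfaceTension f) :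
    ∫⁻ x, ENNReal.ofReal (f (σ x)) ∂μ ≠ ⊤ := by
  have := h.finite
  obtain ⟨L, hL0, hL⟩ := hf.exists_le_mul_norm
  have hle : ∫⁻ x, ENNReal.ofReal (f (σ x)) ∂μ ≤ ENNReal.ofReal L * μ Set.univ := by
    rw [← lintegral_const]
    refine lintegral_mono_ae (h.norm_eq_one.mono fun x hx => ENNReal.ofReal_le_ofReal ?_)
    simpa [hx] using hL (σ x)
  exact (hle.trans_lt (ENNReal.mul_lt_top ENNReal.ofReal_lt_top (measure_lt_top _ _))).ne

/-- The surface energy of a bounded set controls its perimeter. -/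
theorem IsGaussGreen.mul_perimeter_le {n : ℕ} {E : Set (EuclideanSpace ℝ (Fin n))}
    {μ : Measure (EuclideanSpace ℝ (Fin n))} {σ : EuclideanSpace ℝ (Fin n) → EuclideanSpace ℝ (Fin n)}
    (h : IsGaussGreen E μ σ) {R : ℝ} (hER : E ⊆ Metric.ball 0 R)
    {f : EuclideanSpace ℝ (Fin n) → ℝ} (hf : IsSurfaceTension f) {a : EuclideanSpace ℝ (Fin n)} {c : ℝ}
    (hc : ∀ v, ‖v‖ = 1 → c + inner ℝ a v ≤ f v) :
    c * μ.real Set.univ ≤ (∫⁻ x, ENNReal.ofReal (f (σ x)) ∂μ).toReal := by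
  have := h.finite
  have hfm : AEStronglyMeasurable (fun x => f (σ x)) μ :=
    (hf.continuous.measurable.comp h.measurable).aestronglyMeasurable
  have hf0 : 0 ≤ᵐ[μ] fun x => f (σ x) := .of_forall fun x => hf.nonneg _
  have hfi : Integrable (fun x => f (σ x)) μ :=
    (lintegral_ofReal_ne_top_iff_integrable hfm hf0).1 (h.lintegral_ne_top hf)
  have ha : Integrable (fun x => inner ℝ a (σ x)) μ := h.integrable.const_inner a
  rw [← integral_eq_lintegral_of_nonneg_ae hf0 hfm]
  calc c * μ.real Set.univ = ∫ x, (c + inner ℝ a (σ x)) ∂μ := by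
        rw [integral_add (integrable_const c) ha, h.integral_inner_eq_zero hER, integral_const,
          smul_eq_mul, add_zero, mul_comm]
    _ ≤ ∫ x, f (σ x) ∂μ := integral_mono_ae ((integrable_const c).add ha) hfi
        (h.norm_eq_one.mono fun x hx => hc _ hx)

/-! ### Potential energy and limits of the free energy. -/

theorem IsPotential.exists_potentialEnergy_le {n : ℕ} {g : EuclideanSpace ℝ (Fin n) → ℝ}
    (hg : IsPotential g) (R : ℝ) : ∃ M : ENNReal, M ≠ ⊤ ∧
      ∀ T ⊆ Metric.ball (0 : EuclideanSpace ℝ (Fin n)) R, potentialEnergy g T ≤ M * volume T := by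
  have hmem := hg.locallyBounded _ (isCompact_closedBall (0 : EuclideanSpace ℝ (Fin n)) R)
  refine ⟨eLpNorm g ⊤ (volume.restrict (Metric.closedBall 0 R)), hmem.2.ne, fun T hT => ?_⟩
  have hae : ∀ᵐ x ∂(volume.restrict T), ENNReal.ofReal (g x) ≤
      eLpNorm g ⊤ (volume.restrict (Metric.closedBall 0 R)) := by
    refine ae_restrict_of_ae_restrict_of_subset (hT.trans Metric.ball_subset_closedBall) ?_
    rw [eLpNorm_exponent_top]
    filter_upwards [enorm_ae_le_eLpNormEssSup g (volume.restrict (Metric.closedBall 0 R))] with x hx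
    exact (Real.ofReal_le_enorm (g x)).trans hx
  calc potentialEnergy g T ≤ ∫⁻ _ in T, eLpNorm g ⊤ (volume.restrict (Metric.closedBall 0 R)) :=
        lintegral_mono_ae hae
    _ = _ := setLIntegral_const _ _

theorem potentialEnergy_le_add {n : ℕ} (g : EuclideanSpace ℝ (Fin n) → ℝ)
    (S E : Set (EuclideanSpace ℝ (Fin n))) :
    potentialEnergy g S ≤ potentialEnergy g E + potentialEnergy g (symmDiff E S) := by
  refine (lintegral_mono_set (t := E ∪ symmDiff E S) fun x hx => ?_).trans (lintegral_union_le _ _ _)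
  by_cases hxE : x ∈ E
  · exact Or.inl hxE
  · exact Or.inr (Or.inr ⟨hx, hxE⟩)

theorem volume_eq_of_tendsto {α : Type*} [MeasurableSpace α] {ν : Measure α} {l : Filter ℕ} [l.NeBot]
    {E : ℕ → Set α} {S : Set α} {v : ENNReal} (hE : ∀ k, ν (E k) = v)
    (h : Tendsto (fun k => ν (symmDiff (E k) S)) l (𝓝 0)) : ν S = v := by
  have hle : ∀ A B : Set α, ν A ≤ ν B + ν (symmDiff A B) := fun A B => by
    refine (measure_mono fun x hx => ?_).trans (measure_union_le _ _)
    by_cases hxB : x ∈ B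
    · exact Or.inl hxB
    · exact Or.inr (Or.inl ⟨hx, hxB⟩)
  refine le_antisymm ?_ ?_
  · refine ge_of_tendsto' (by simpa using tendsto_const_nhds.add h) fun k => ?_
    rw [← hE k, symmDiff_comm]
    exact hle S (E k)
  · refine ge_of_tendsto' (by simpa using tendsto_const_nhds.add h) fun k => ?_
    rw [← hE k]
    exact hle (E k) S

/-- Along an ultrafilter, sets in a ball whose free energy converges from above to `e` have a limit
in measure of free energy at most `e`. -/
theorem exists_limit_freeEnergy_le {n : ℕ} {f g : EuclideanSpace ℝ (Fin n) → ℝ}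
    (hf : IsSurfaceTension f) (hK : (wulffShape f).Nonempty) (hg : IsPotential g) {R e : ℝ}
    (𝒰 : Ultrafilter ℕ) (h𝒰 : (𝒰 : Filter ℕ) ≤ atTop) {E : ℕ → Set (EuclideanSpace ℝ (Fin n))}
    (hE : ∀ k, HasFinitePerimeter (E k)) (hER : ∀ k, E k ⊆ Metric.ball 0 R)
    (he : ∀ k, (surfaceEnergy f (E k)).toReal + (potentialEnergy g (E k)).toReal ≤ e + 1 / (k + 1)) :
    ∃ S, HasFinitePerimeter S ∧ Tendsto (fun k => volume (symmDiff (E k) S)) 𝒰 (𝓝 0) ∧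
      freeEnergy f g S ≤ ENNReal.ofReal e := by
  obtain ⟨a, c, hc0, hc⟩ := hf.exists_coercive hK
  obtain ⟨M, hMtop, hM⟩ := hg.exists_potentialEnergy_le R
  have hGG := fun k => (hE k).isGaussGreen
  have hFtop : ∀ k, surfaceEnergy f (E k) ≠ ⊤ := fun k => by
    rw [(hE k).surfaceEnergy_eq]
    exact (hGG k).lintegral_ne_top hf
  have hGtop : ∀ T ⊆ Metric.ball (0 : EuclideanSpace ℝ (Fin n)) R, potentialEnergy g T ≠ ⊤ :=
    fun T hT => ((hM T hT).trans_lt (ENNReal.mul_lt_top hMtop.lt_top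
      ((measure_mono hT).trans_lt measure_ball_lt_top))).ne
  have hFe : ∀ k, (surfaceEnergy f (E k)).toReal ≤ e + 1 := by
    intro k
    have h1 : (1 : ℝ) / (k + 1) ≤ 1 := by
      rw [div_le_one (by positivity)]
      linarith [Nat.cast_nonneg (α := ℝ) k]
    linarith [he k, (ENNReal.toReal_nonneg (a := potentialEnergy g (E k)))]
  have hP : ∀ k, (perimeterMeasure (E k)).real Set.univ ≤ (e + 1) / c := by
    intro k
    rw [le_div_iff₀ hc0, mul_comm]
    refine ((hGG k).mul_perimeter_le (hER k) hf hc).trans ?_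
    rw [← (hE k).surfaceEnergy_eq]
    exact hFe k
  have hEm := fun k => (hE k).1
  obtain ⟨S, hSm, hSR, hSlim⟩ := exists_tendsto_volume_symmDiff 𝒰 hGG hEm hER hP
  obtain ⟨ν, τ, hντ⟩ := exists_isGaussGreen_limit 𝒰 hGG hEm hP hSm.nullMeasurableSet hSlim
  have hS : HasFinitePerimeter S := ⟨hSm.nullMeasurableSet, ⟨(ν, τ), hντ⟩⟩
  refine ⟨S, hS, hSlim, ?_⟩
  -- The bound `e` is split as `ℓ + (e - ℓ)`: semicontinuity bounds the surface energy of `S` by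
  -- `ℓ`, and the potential energy takes the remainder.
  obtain ⟨ℓ, hℓ⟩ := exists_tendsto_of_abs_le 𝒰 (u := fun k => (surfaceEnergy f (E k)).toReal)
    (M := e + 1) fun k => by
      rw [abs_of_nonneg ENNReal.toReal_nonneg]
      exact hFe k
  have hℓ0 : 0 ≤ ℓ := ge_of_tendsto' hℓ fun k => ENNReal.toReal_nonneg
  have hSF : ∀ t : ℝ, 0 < t → surfaceEnergy f S ≤ ENNReal.ofReal (ℓ + t) := by
    intro t ht
    rw [hS.surfaceEnergy_eq]
    refine hf.lintegral_le_of_tendsto 𝒰 (C := e + 1) hGG hEm (fun k => ?_) hSm.nullMeasurableSet hSlim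
      hS.isGaussGreen (by positivity) ?_
    · rw [← (hE k).surfaceEnergy_eq, ENNReal.le_ofReal_iff_toReal_le (hFtop k)
        (ENNReal.toReal_nonneg.trans (hFe k))]
      exact hFe k
    · filter_upwards [hℓ.eventually (gt_mem_nhds (show ℓ < ℓ + t by linarith))] with k hk
      rw [← (hE k).surfaceEnergy_eq, ENNReal.le_ofReal_iff_toReal_le (hFtop k) (by positivity)]
      exact hk.le
  have hSFtop : surfaceEnergy f S ≠ ⊤ := ((hSF 1 one_pos).trans_lt ENNReal.ofReal_lt_top).ne
  have hSF' : (surfaceEnergy f S).toReal ≤ ℓ := le_of_forall_pos_le_add fun t ht =>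
    ENNReal.toReal_le_of_le_ofReal (by positivity) (hSF t ht)
  have hSG : (potentialEnergy g S).toReal ≤ e - ℓ := by
    have h1 : Tendsto (fun k : ℕ => e + 1 / ((k : ℝ) + 1) - (surfaceEnergy f (E k)).toReal
        + (M * volume (symmDiff (E k) S)).toReal) 𝒰 (𝓝 (e + 0 - ℓ + 0)) := by
      refine ((tendsto_const_nhds.add (tendsto_one_div_add_atTop_nhds_zero_nat.mono_left h𝒰)).sub
        hℓ).add ?_
      have h2 : Tendsto (fun k => M * volume (symmDiff (E k) S)) 𝒰 (𝓝 0) := by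
        simpa using ENNReal.Tendsto.const_mul hSlim (Or.inr hMtop)
      exact (ENNReal.tendsto_toReal ENNReal.zero_ne_top).comp h2
    rw [add_zero, add_zero] at h1
    refine ge_of_tendsto' h1 fun k => ?_
    have hsub : symmDiff (E k) S ⊆ Metric.ball 0 R :=
      (Set.symmDiff_subset_union).trans (Set.union_subset (hER k) hSR)
    have hvtop : M * volume (symmDiff (E k) S) ≠ ⊤ := ENNReal.mul_ne_top hMtop
      ((measure_mono hsub).trans_lt measure_ball_lt_top).ne
    have h3 := ENNReal.toReal_mono (ENNReal.add_ne_top.2 ⟨hGtop _ (hER k), hvtop⟩)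
      ((potentialEnergy_le_add g S (E k)).trans (add_le_add le_rfl (hM _ hsub)))
    rw [ENNReal.toReal_add (hGtop _ (hER k)) hvtop] at h3
    linarith [he k]
  rw [freeEnergy, ← ENNReal.ofReal_toReal hSFtop, ← ENNReal.ofReal_toReal (hGtop S hSR),
    ← ENNReal.ofReal_add ENNReal.toReal_nonneg ENNReal.toReal_nonneg]
  exact ENNReal.ofReal_le_ofReal (by linarith)

end Almgren

/-! ### The contradiction argument. -/

theorem mainTheorem3 {n : ℕ} (f g : EuclideanSpace ℝ (Fin n) → ℝ)
    (hf : Almgren.IsSurfaceTension f) (hK : (Almgren.wulffShape f).Nonempty)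
    (hg : Almgren.IsPotential g) (m : ℝ) (hm : 0 < m)
    (Em : Set (EuclideanSpace ℝ (Fin n))) (hEm : Almgren.IsMinimizer f g m Em)
    (huniq : ∀ E' : Set (EuclideanSpace ℝ (Fin n)), Almgren.IsMinimizer f g m E' →
      E' =ᵐ[MeasureTheory.volume] Em)
    (R : ℝ) (hR : 0 < R) (ε : ℝ) (hε : 0 < ε) :
    ∃ w : ℝ, 0 < w ∧ ∀ E : Set (EuclideanSpace ℝ (Fin n)),
      Almgren.HasFinitePerimeter E → E ⊆ Metric.ball 0 R →
      MeasureTheory.volume E = ENNReal.ofReal m →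
      Almgren.energyGap f g E Em < w →
      MeasureTheory.volume.real (symmDiff Em E) / MeasureTheory.volume.real Em < ε := by
  by_contra! hcon
  choose E hE hER hEv hEgap hEε using fun k : ℕ =>
    hcon (1 / ((k : ℝ) + 1)) (by positivity)
  obtain ⟨M, hMtop, hM⟩ := hg.exists_potentialEnergy_le R
  -- `Em` need not be bounded; its energy is finite by comparison with `E 0`. Without this the
  -- `toReal` values in the gap would not represent energies.
  have hEm_top : Almgren.freeEnergy f g Em ≠ ⊤ := by
    refine ((hEm.le (E 0) (hE 0) (hEv 0)).trans_lt (ENNReal.add_lt_top.2 ⟨?_, ?_⟩)).ne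
    · rw [(hE 0).surfaceEnergy_eq]
      exact ((hE 0).isGaussGreen.lintegral_ne_top hf).lt_top
    · refine (hM _ (hER 0)).trans_lt (ENNReal.mul_lt_top hMtop.lt_top ?_)
      rw [hEv 0]
      exact ENNReal.ofReal_lt_top
  obtain ⟨hFtop, hGtop⟩ := ENNReal.add_ne_top.1 hEm_top
  obtain ⟨S, hS, hSlim, hSle⟩ := Almgren.exists_limit_freeEnergy_le hf hK hg (R := R)
    (e := (Almgren.freeEnergy f g Em).toReal) (hyperfilter ℕ) Nat.hyperfilter_le_atTop hE hER (by
      intro k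
      have h1 := (abs_lt.1 (hEgap k)).2
      rw [Almgren.freeEnergy, ENNReal.toReal_add hFtop hGtop]
      linarith)
  rw [ENNReal.ofReal_toReal hEm_top] at hSle
  -- Mass passes to the limit because all `E k` lie in one ball, so the compactness is in measure on
  -- the whole space.
  have hSE := huniq S ⟨hS, Almgren.volume_eq_of_tendsto hEv hSlim,
    fun E' h1 h2 => hSle.trans (hEm.le E' h1 h2)⟩
  have hlim : Tendsto (fun k => volume.real (symmDiff Em (E k)) / volume.real Em) (hyperfilter ℕ)
      (𝓝 0) := by
    have h1 : ∀ k, volume (symmDiff (E k) S) = volume (symmDiff Em (E k)) := fun k => by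
      rw [symmDiff_comm Em]
      exact measure_congr ((ae_eq_refl (E k)).symmDiff hSE)
    simp only [h1] at hSlim
    simpa [Measure.real, Function.comp_def] using
      ((ENNReal.tendsto_toReal ENNReal.zero_ne_top).comp hSlim).div_const (volume.real Em)
  exact absurd (ge_of_tendsto' hlim hEε) (not_le.2 hε)
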